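/- Let $\mathbb{H}$ be the upper half-plane, $\mathbb{D}$ the open unit disc in $\mathbb{C}$, and $\rho = e^{\pi i/3} = \frac{1+i\sqrt3}{2}$. For $\tau\in\mathbb{H}$ and $q=e^{2\pi i\tau}$ let $\Delta(\tau)=q\prod_{n\ge1}(1-q^n)^{24}$ be the modular discriminant, $j(\tau)=E_4(\tau)^3/\Delta(\tau)=q^{-1}+744+\cdots$ the $j$-invariant (with $E_4$ the Eisenstein series of weight $4$ with constant term $1$), and $$g_\infty(\tau)=-\log\bigl((4\pi\,\Im\tau)^6|\Delta(\tau)|\bigr).$$ Let $\psi\colon\mathbb{D}\to\mathbb{H}$, $\psi(w)=\frac{\overline{\rho}\,w+\rho}{w+1}$, and for $w\in\mathbb{D}$ put $$g_{\mathbb{D}}(w)=g_\infty(\psi(w)),\qquad \widehat h(w)=\frac{\Delta(\psi(w))}{(1+w)^{12}}.$$ There is a holomorphic function $f\colon\mathbb{D}\to\mathbb{C}$ (clearly unique) such that $j(\psi(w))=f(w^3)$ for every $w\in\mathbb{D}$, and $f'(0)$ is real; moreover there is a holomorphic branch of $\log\widehat h$ on $\mathbb{D}$. For every $w\in\mathbb{D}$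 with $|w|\le 1-\frac{\pi}{2\sqrt3}$, and for any such branch, $$\left|g_{\mathbb{D}}(w)-\left(g_{\mathbb{D}}(0)-6\log(1-|w|^2)-\frac{f'(0)}{13824}\Re(w^3)\right)\right|\le 6^3|w|^6,$$ $$\left|(\log\widehat h)'(w)\,w-\frac{3f'(0)}{13824}\,w^3\right|\le 6^4|w|^6,$$ $$\left|(\log\widehat h)''(w)\,w^2-\frac{6f'(0)}{13824}\,w^3\right|\le 5\cdot 6^4|w|^6.$$ -/

import Mathlib

open UpperHalfPlane

noncomputable section

namespace FaltingsApprox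

/-- The point `ρ = (1 + i√3)/2 = e^{πi/3}`. -/
def rho : ℂ := ⟨1 / 2, Real.sqrt 3 / 2⟩

/-- The Möbius map `ψ(w) = (ρ̄ w + ρ)/(w + 1)`, which sends the unit disc to the upper half-plane
and `0` to `ρ`. -/
def psi (w : ℂ) : ℂ := ((starRingEnd ℂ) rho * w + rho) / (w + 1)

theorem psi_im (w : ℂ) :
    (psi w).im = Real.sqrt 3 / 2 * ((1 - ‖w‖ ^ 2) / ‖1 + w‖ ^ 2) := by
  rw [← Complex.normSq_eq_norm_sq, ← Complex.normSq_eq_norm_sq, add_comm 1 w]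
  simp only [psi, rho, Complex.div_im, Complex.add_re, Complex.add_im, Complex.mul_re,
    Complex.mul_im, Complex.conj_re, Complex.conj_im, Complex.one_re, Complex.one_im,
    Complex.normSq_apply w]
  ring

theorem psi_im_pos {w : ℂ} (hw : w ∈ Metric.ball (0 : ℂ) 1) : 0 < (psi w).im := by
  have h1 : ‖w‖ < 1 := by simpa using hw
  have h2 : 0 < ‖1 + w‖ := by
    refine norm_pos_iff.mpr fun h => ?_
    have : w = -1 := by linear_combination h
    rw [this] at h1
    simp at h1
  have h3 : 0 < 1 - ‖w‖ ^ 2 := by nlinarith [norm_nonneg w]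
  rw [psi_im]
  positivity

/-- The modular `j`-invariant `j = E₄³/Δ = 1/q + 744 + ⋯`. -/
def jInv (τ : ℍ) : ℂ := ModularForm.E₄ τ ^ 3 / ModularForm.discriminant τ

/-- The hyperbolic Green function `g_∞(τ) = -log((4π Im τ)⁶ |Δ(τ)|)`. -/
def gInfty (τ : ℍ) : ℝ :=
  -Real.log ((4 * Real.pi * τ.im) ^ 6 * ‖ModularForm.discriminant τ‖)

/-- `j_𝔻 = j ∘ ψ`; only its values on the open unit disc, where `0 < Im (ψ w)`, are meaningful. -/
def jDisc (w : ℂ) : ℂ := jInv (ofComplex (psi w))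

/-- `g_𝔻 = g_∞ ∘ ψ`; only its values on the open unit disc are meaningful. -/
def gDisc (w : ℂ) : ℝ := gInfty (ofComplex (psi w))

/-- `ĥ(w) = Δ(ψ(w)) / (1 + w)¹²`; only its values on the open unit disc are meaningful. -/
def hHat (w : ℂ) : ℂ := ModularForm.discriminant (ofComplex (psi w)) / (1 + w) ^ 12

/-- `f` is the holomorphic function on the unit disc with `j_𝔻(w) = f(w³)`. -/
def IsCubicFactor (f : ℂ → ℂ) : Prop :=
  DifferentiableOn ℂ f (Metric.ball 0 1) ∧ ∀ w ∈ Metric.ball (0 : ℂ) 1, jDisc w = f (w ^ 3)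

/-- `L` is a holomorphic branch of `log ĥ` on the unit disc. -/
def IsLogBranch (L : ℂ → ℂ) : Prop :=
  DifferentiableOn ℂ L (Metric.ball 0 1) ∧
    ∀ w ∈ Metric.ball (0 : ℂ) 1, Complex.exp (L w) = hHat w

end FaltingsApprox

end

/-!
A branch `L` of `log ĥ` is invariant under rotation by `2π/3`, which comes from the stabilizer of
`ρ` in the modular group, so `L(w) = L(0) + Φ(w³)`, and each of the three estimates bounds the
remainder of `Φ(z)` or of its derivatives after the linear term `Φ'(0) z`.

The Petersson norm of `Δ` is bounded on the fundamental domain, hence on `ℍ`; read on the disc, this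
bounds `Re Φ` from above on a disc of radius `(9/10)³`. A second-order Borel–Carathéodory inequality
then bounds `(Φ(z) - Φ'(0) z) / z²`, and Cauchy's estimates bound its derivatives.

The coefficient comes from Ramanujan's identities. Since `DΔ = E₂Δ` and `12 DE₂ = E₂² - E₄`, the
function `L` satisfies `(2π√3)² E₄(ψ(w)) / (1 + w)⁴ = L'² - 12 L''`, which expresses `Φ'(0)` through
the derivative at `0` of the left-hand side; as `E₄(ρ) = 0` and `3 DE₄ = E₂E₄ - E₆`, that derivative
is a multiple of `E₆(ρ)`. Dividing the cube of the left-hand side by `ĥ` expresses `f'(0)` through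
`E₆(ρ)` as well, and `E₆(ρ)` is real because `q = -exp(-π√3)` at `ρ`.
-/

noncomputable section

namespace FaltingsApprox

open Metric Set Filter Topology

section PowerFactorization

variable {F : ℂ → ℂ} {ζ : ℂ} {n : ℕ} [NeZero n] {r : ℝ}

theorem eq_of_pow_eq_pow_of_rotation_invariant (hζ : IsPrimitiveRoot ζ n)
    (hinv : ∀ w ∈ ball (0 : ℂ) r, F (ζ * w) = F w) {w w' : ℂ} (hw : w ∈ ball (0 : ℂ) r)
    (h : w' ^ n = w ^ n) : F w' = F w := by
  have hpow (i : ℕ) : F (ζ ^ i * w) = F w := by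
    induction i with
    | zero => simp
    | succ i ih =>
      rw [pow_succ', mul_assoc, hinv, ih]
      simpa [hζ.norm'_eq_one (NeZero.ne n)] using hw
  rcases eq_or_ne w 0 with rfl | hw0
  · rw [eq_zero_of_pow_eq_zero (h.trans (zero_pow (NeZero.ne n)))]
  obtain ⟨i, -, hi⟩ := hζ.eq_pow_of_pow_eq_one (ξ := w' / w) <| by
    rw [div_pow, h, div_self (pow_ne_zero n hw0)]
  rw [← hpow i, hi, div_mul_cancel₀ w' hw0]

theorem exists_differentiableAt_root (n : ℕ) [NeZero n] {z : ℂ} (hz : z ≠ 0) :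
    ∃ c : ℂ → ℂ, DifferentiableAt ℂ c z ∧ ∀ x, c x ^ n = x := by
  refine ⟨fun x ↦ z ^ (n : ℂ)⁻¹ * (x / z) ^ (n : ℂ)⁻¹, ?_, fun x ↦ ?_⟩
  · refine ((differentiableAt_id.div_const z).cpow_const ?_).const_mul _
    simp [hz]
  · rw [mul_pow, Complex.cpow_nat_inv_pow _ (NeZero.ne n), Complex.cpow_nat_inv_pow _ (NeZero.ne n),
      mul_div_cancel₀ x hz]

theorem continuousAt_zero_cpow_nat_inv (n : ℕ) [NeZero n] :
    ContinuousAt (fun z : ℂ ↦ z ^ (n : ℂ)⁻¹) 0 := by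
  have hn : 0 < n := NeZero.pos n
  refine Complex.continuousAt_cpow_const_of_re_pos (by simp) ?_
  rw [← Complex.ofReal_natCast, ← Complex.ofReal_inv, Complex.ofReal_re]
  positivity

/- Away from `0` the factor is locally `F ∘ c` for a holomorphic branch `c` of the root; at `0` the
singularity is removable because the principal root is continuous there. -/
theorem exists_differentiableOn_comp_pow (hr : 0 < r) (hζ : IsPrimitiveRoot ζ n)
    (hF : DifferentiableOn ℂ F (ball 0 r)) (hinv : ∀ w ∈ ball (0 : ℂ) r, F (ζ * w) = F w) :
    ∃ f : ℂ → ℂ, DifferentiableOn ℂ f (ball 0 (r ^ n)) ∧ ∀ w ∈ ball (0 : ℂ) r, F w = f (w ^ n) := by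
  have hn : n ≠ 0 := NeZero.ne n
  have hroot (z : ℂ) : (z ^ (n : ℂ)⁻¹) ^ n = z := Complex.cpow_nat_inv_pow z hn
  refine ⟨fun z ↦ F (z ^ (n : ℂ)⁻¹), ?_, fun w hw ↦
    (eq_of_pow_eq_pow_of_rotation_invariant hζ hinv hw (hroot _)).symm⟩
  rw [← Complex.differentiableOn_compl_singleton_and_continuousAt_iff
    (ball_mem_nhds 0 (by positivity))]
  constructor
  · rintro z ⟨hz, hz0⟩
    obtain ⟨c, hc, hcn⟩ := exists_differentiableAt_root n hz0
    have hcz : ball (0 : ℂ) r ∈ 𝓝 (c z) := isOpen_ball.mem_nhds <| by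
      rw [mem_ball_zero_iff] at hz ⊢
      rw [← hcn z, norm_pow] at hz
      exact lt_of_pow_lt_pow_left₀ n hr.le hz
    refine (((hF.differentiableAt hcz).comp z hc).congr_of_eventuallyEq ?_).differentiableWithinAt
    filter_upwards [hc.continuousAt.preimage_mem_nhds hcz] with x hx
    exact eq_of_pow_eq_pow_of_rotation_invariant hζ hinv hx ((hroot x).trans (hcn x).symm)
  · refine ContinuousAt.comp (g := F) ?_ (continuousAt_zero_cpow_nat_inv n)
    rw [Complex.zero_cpow (inv_ne_zero (Nat.cast_ne_zero.mpr hn))]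
    exact (hF.differentiableAt (ball_mem_nhds 0 hr)).continuousAt

end PowerFactorization

theorem deriv_zero_eq_of_comp_pow {f g : ℂ → ℂ} {n : ℕ} (hn : n ≠ 0) (hf : DifferentiableAt ℂ f 0)
    (hg : ContinuousAt g 0) (h : ∀ᶠ w in 𝓝 0, f (w ^ n) = w ^ n * g w) : deriv f 0 = g 0 := by
  have hpow : Tendsto (fun w : ℂ ↦ w ^ n) (𝓝[≠] 0) (𝓝[≠] 0) := by
    refine tendsto_nhdsWithin_iff.mpr ⟨?_, eventually_mem_nhdsWithin.mono fun w hw ↦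
      pow_ne_zero n hw⟩
    have : ContinuousAt (fun w : ℂ ↦ w ^ n) 0 := by fun_prop
    simpa [hn] using this.tendsto.mono_left nhdsWithin_le_nhds
  have hf0 : f 0 = 0 := by simpa [hn] using h.self_of_nhds
  have hslope := (hasDerivAt_iff_tendsto_slope.mp hf.hasDerivAt).comp hpow
  refine tendsto_nhds_unique (hslope.congr' ?_) (hg.tendsto.mono_left nhdsWithin_le_nhds)
  filter_upwards [h.filter_mono nhdsWithin_le_nhds, eventually_mem_nhdsWithin] with w hw hw0
  have : w ^ n ≠ 0 := pow_ne_zero n hw0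
  rw [Function.comp_apply, slope_def_field, hw, hf0, sub_zero, sub_zero,
    mul_div_cancel_left₀ _ this]

section Logarithm

variable {U : Set ℂ} {L L₁ L₂ h : ℂ → ℂ}

theorem deriv_eq_div_of_exp_eq (hU : IsOpen U) (hL : DifferentiableOn ℂ L U)
    (hexp : ∀ w ∈ U, Complex.exp (L w) = h w) {w : ℂ} (hw : w ∈ U) :
    deriv L w = deriv h w / h w := by
  have hderiv := (hL.differentiableAt (hU.mem_nhds hw)).hasDerivAt.cexp
  have heq : h =ᶠ[𝓝 w] fun x ↦ Complex.exp (L x) := by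
    filter_upwards [hU.mem_nhds hw] with x hx using (hexp x hx).symm
  rw [heq.deriv_eq, hderiv.deriv, ← hexp w hw, mul_div_cancel_left₀ _ (Complex.exp_ne_zero _)]

theorem sub_eq_sub_of_exp_eq (hU : IsOpen U) (hc : IsPreconnected U) (h₁ : DifferentiableOn ℂ L₁ U)
    (h₂ : DifferentiableOn ℂ L₂ U) (hexp : ∀ w ∈ U, Complex.exp (L₁ w) = Complex.exp (L₂ w))
    {w w' : ℂ} (hw : w ∈ U) (hw' : w' ∈ U) : L₁ w - L₂ w = L₁ w' - L₂ w' := by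
  refine hU.is_const_of_deriv_eq_zero hc (h₁.sub h₂) (fun x hx ↦ ?_) hw hw'
  rw [deriv_sub (h₁.differentiableAt (hU.mem_nhds hx)) (h₂.differentiableAt (hU.mem_nhds hx)),
    deriv_eq_div_of_exp_eq hU h₁ hexp hx,
    deriv_eq_div_of_exp_eq hU h₂ (fun _ _ ↦ rfl) hx, sub_self]
  rfl

theorem exists_log_of_ne_zero {c : ℂ} {r : ℝ} (hh : DifferentiableOn ℂ h (ball c r))
    (h0 : ∀ w ∈ ball c r, h w ≠ 0) :
    ∃ L : ℂ → ℂ, DifferentiableOn ℂ L (ball c r) ∧ ∀ w ∈ ball c r, Complex.exp (L w) = h w := by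
  have hlog : DifferentiableOn ℂ (fun w ↦ deriv h w / h w) (ball c r) :=
    (hh.deriv isOpen_ball).div hh h0
  obtain ⟨L, hLc, hL⟩ := hlog.isExactOn_ball.with_val_at c (Complex.log (h c))
  refine ⟨L, fun w hw ↦ (hL w hw).differentiableAt.differentiableWithinAt, fun w hw ↦ ?_⟩
  have hderiv (x : ℂ) (hx : x ∈ ball c r) : HasDerivAt (fun w ↦ Complex.exp (-L w) * h w) 0 x := by
    have hhx := (hh.differentiableAt (isOpen_ball.mem_nhds hx)).hasDerivAt
    refine ((hL x hx).neg.cexp.mul hhx).congr_deriv ?_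
    rw [mul_neg, neg_mul, mul_assoc, div_mul_cancel₀ _ (h0 x hx), Pi.neg_apply, neg_add_cancel]
  have hc : c ∈ ball c r := mem_ball_self (pos_of_mem_ball hw)
  have hconst : Complex.exp (-L w) * h w = Complex.exp (-L c) * h c :=
    isOpen_ball.is_const_of_deriv_eq_zero (convex_ball c r).isPreconnected
      (fun x hx ↦ (hderiv x hx).differentiableAt.differentiableWithinAt)
      (fun x hx ↦ (hderiv x hx).deriv) hw hc
  rw [hLc, Complex.exp_neg, Complex.exp_neg, Complex.exp_log (h0 c hc),
    inv_mul_cancel₀ (h0 c hc)] at hconst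
  exact (eq_of_inv_mul_eq_one hconst)

end Logarithm

section BorelCaratheodory

variable {G : ℂ → ℂ} {R : ℝ}

theorem norm_dslope_le_of_norm_le_one (hG : DifferentiableOn ℂ G (ball 0 R)) (hG0 : G 0 = 0)
    (hle : ∀ z ∈ ball (0 : ℂ) R, ‖G z‖ ≤ 1) {z : ℂ} (hz : z ∈ ball (0 : ℂ) R) :
    ‖dslope G 0 z‖ ≤ 1 / R :=
  Complex.norm_dslope_le_div_of_mapsTo_ball hG (fun x hx ↦ by simpa [hG0] using hle x hx) hz

theorem norm_dslope_dslope_le_of_norm_le_one (hG : DifferentiableOn ℂ G (ball 0 R)) (hG0 : G 0 = 0)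
    (hle : ∀ z ∈ ball (0 : ℂ) R, ‖G z‖ ≤ 1) {z : ℂ} (hz : z ∈ ball (0 : ℂ) R) :
    ‖dslope (dslope G 0) 0 z‖ ≤ 2 / R ^ 2 := by
  have h0 : (0 : ℂ) ∈ ball (0 : ℂ) R := mem_ball_self (pos_of_mem_ball hz)
  have hH := (Complex.differentiableOn_dslope (isOpen_ball.mem_nhds h0)).mpr hG
  have hmaps : MapsTo (dslope G 0) (ball 0 R) (closedBall (dslope G 0 0) (1 / R + 1 / R)) := by
    intro x hx
    rw [mem_closedBall, dist_eq_norm]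
    exact (norm_sub_le _ _).trans (add_le_add (norm_dslope_le_of_norm_le_one hG hG0 hle hx)
      (norm_dslope_le_of_norm_le_one hG hG0 hle h0))
  calc ‖dslope (dslope G 0) 0 z‖ ≤ (1 / R + 1 / R) / R :=
        Complex.norm_dslope_le_div_of_mapsTo_ball hH hmaps hz
    _ = 2 / R ^ 2 := by ring

variable {Φ : ℂ → ℂ} {A : ℝ}

theorem exists_cayley_of_re_le (hA : 0 < A) (hΦ : DifferentiableOn ℂ Φ (ball 0 R)) (h0 : Φ 0 = 0)
    (hre : ∀ z ∈ ball (0 : ℂ) R, (Φ z).re ≤ A) :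
    ∃ G : ℂ → ℂ, DifferentiableOn ℂ G (ball 0 R) ∧ G 0 = 0 ∧ (∀ z ∈ ball (0 : ℂ) R, ‖G z‖ ≤ 1) ∧
      ∀ z ∈ ball (0 : ℂ) R, Φ z * (1 + G z) = 2 * A * G z := by
  have hne (z : ℂ) (hz : z ∈ ball (0 : ℂ) R) : 2 * (A : ℂ) - Φ z ≠ 0 := by
    intro h
    have hre_eq : 2 * A - (Φ z).re = 0 := by simpa using congrArg Complex.re h
    linarith [hre z hz]
  refine ⟨fun z ↦ Φ z / (2 * A - Φ z), hΦ.div (hΦ.const_sub _) hne, by simp [h0], fun z hz ↦ ?_,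
    fun z hz ↦ ?_⟩
  · rw [norm_div]
    refine div_le_one_of_le₀ ?_ (norm_nonneg _)
    rw [← sq_le_sq₀ (norm_nonneg _) (norm_nonneg _), Complex.sq_norm, Complex.sq_norm,
      Complex.normSq_apply, Complex.normSq_apply]
    simp only [Complex.sub_re, Complex.sub_im, Complex.mul_re, Complex.mul_im, Complex.re_ofNat,
      Complex.im_ofNat, Complex.ofReal_re, Complex.ofReal_im]
    nlinarith [hre z hz]
  · have := hne z hz
    field_simp
    ring

theorem one_sub_div_le_norm_one_add_mul {z u : ℂ} (hu : ‖u‖ ≤ 1 / R) :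
    1 - ‖z‖ / R ≤ ‖1 + z * u‖ := by
  have hzu : ‖z * u‖ ≤ ‖z‖ / R := by
    rw [norm_mul, div_eq_mul_one_div]
    gcongr
  have htri := norm_sub_le_norm_add 1 (z * u)
  rw [norm_one] at htri
  linarith

theorem norm_cayley_remainder_le (hA : 0 ≤ A) {z u u₀ v : ℂ} (hz : ‖z‖ < R)
    (hu : ‖u‖ ≤ 1 / R) (hu₀ : ‖u₀‖ ≤ 1 / R) (hv : ‖v‖ ≤ 2 / R ^ 2) :
    ‖2 * A * (v - u₀ * u) / (1 + z * u)‖ ≤ 6 * A / (R * (R - ‖z‖)) := by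
  have hR : 0 < R := (norm_nonneg z).trans_lt hz
  have hsub : ‖v - u₀ * u‖ ≤ 2 / R ^ 2 + 1 / R * (1 / R) := by
    refine (norm_sub_le _ _).trans (add_le_add hv ?_)
    rw [norm_mul]
    gcongr
  have hpos : 0 < 1 - ‖z‖ / R := by rwa [sub_pos, div_lt_one hR]
  have hne : R - ‖z‖ ≠ 0 := (sub_pos.mpr hz).ne'
  calc ‖2 * A * (v - u₀ * u) / (1 + z * u)‖ = 2 * A * ‖v - u₀ * u‖ / ‖1 + z * u‖ := by
        rw [norm_div, norm_mul, norm_mul, Complex.norm_real, Real.norm_of_nonneg hA,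
          Complex.norm_ofNat]
    _ ≤ 2 * A * (2 / R ^ 2 + 1 / R * (1 / R)) / (1 - ‖z‖ / R) := by
        gcongr
        exact one_sub_div_le_norm_one_add_mul hu
    _ = 6 * A / (R * (R - ‖z‖)) := by
        rw [one_sub_div hR.ne']
        field_simp
        ring

/- With the Cayley transform `G = Φ / (2A - Φ)`, `H = G / z` and `K = (H - H 0) / z`, the quadratic
remainder of `Φ = 2AG / (1 + G)` is `2A (K - H 0 * H) / (1 + zH)`, and Schwarz's lemma bounds `H`
and `K`. -/
theorem exists_quadratic_remainder_of_re_le (hR : 0 < R) (hA : 0 < A)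
    (hΦ : DifferentiableOn ℂ Φ (ball 0 R)) (h0 : Φ 0 = 0)
    (hre : ∀ z ∈ ball (0 : ℂ) R, (Φ z).re ≤ A) :
    ∃ χ : ℂ → ℂ, DifferentiableOn ℂ χ (ball 0 R) ∧
      (∀ z ∈ ball (0 : ℂ) R, Φ z = deriv Φ 0 * z + z ^ 2 * χ z) ∧
      ∀ z ∈ ball (0 : ℂ) R, ‖χ z‖ ≤ 6 * A / (R * (R - ‖z‖)) := by
  obtain ⟨G, hG, hG0, hGle, hΦG⟩ := exists_cayley_of_re_le hA hΦ h0 hre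
  have hR0 : ball (0 : ℂ) R ∈ 𝓝 (0 : ℂ) := ball_mem_nhds 0 hR
  set H := dslope G 0
  set K := dslope H 0
  have hH : DifferentiableOn ℂ H (ball 0 R) := (Complex.differentiableOn_dslope hR0).mpr hG
  have hK : DifferentiableOn ℂ K (ball 0 R) := (Complex.differentiableOn_dslope hR0).mpr hH
  have hGH (z : ℂ) : G z = z * H z := by simpa [hG0] using (sub_smul_dslope G 0 z).symm
  have hHK (z : ℂ) : H z - H 0 = z * K z := by simpa using (sub_smul_dslope H 0 z).symm
  have hHle {z : ℂ} (hz : z ∈ ball (0 : ℂ) R) : ‖H z‖ ≤ 1 / R :=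
    norm_dslope_le_of_norm_le_one hG hG0 hGle hz
  have hne (z : ℂ) (hz : z ∈ ball (0 : ℂ) R) : 1 + z * H z ≠ 0 := by
    refine norm_pos_iff.mp (lt_of_lt_of_le ?_ (one_sub_div_le_norm_one_add_mul (hHle hz)))
    rwa [sub_pos, div_lt_one hR, ← mem_ball_zero_iff]
  set χ : ℂ → ℂ := fun z ↦ 2 * A * (K z - H 0 * H z) / (1 + z * H z)
  have hχ : DifferentiableOn ℂ χ (ball 0 R) := ((hK.sub (hH.const_mul _)).const_mul _).div
    ((differentiableOn_id.mul hH).const_add 1) hne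
  have hΦχ (z : ℂ) (hz : z ∈ ball (0 : ℂ) R) : Φ z = z * (2 * A * H 0 + z * χ z) := by
    have hz1 := hne z hz
    have hz2 : Φ z * (1 + z * H z) = 2 * A * (z * H z) := hGH z ▸ hΦG z hz
    simp only [χ]
    field_simp
    linear_combination hz2 + 2 * A * z * hHK z
  have hderiv : deriv Φ 0 = 2 * A * H 0 := by
    have hcont : ContinuousAt (fun z ↦ 2 * A * H 0 + z * χ z) 0 :=
      continuousAt_const.add (continuousAt_id.mul (hχ.differentiableAt hR0).continuousAt)
    simpa using deriv_zero_eq_of_comp_pow one_ne_zero (hΦ.differentiableAt hR0) hcont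
      (by filter_upwards [hR0] with z hz using by simpa using hΦχ z hz)
  refine ⟨χ, hχ, fun z hz ↦ ?_, fun z hz ↦ ?_⟩
  · rw [hΦχ z hz, hderiv]
    ring
  · exact norm_cayley_remainder_le hA.le (mem_ball_zero_iff.mp hz) (hHle hz)
      (hHle (mem_ball_self hR)) (norm_dslope_dslope_le_of_norm_le_one hG hG0 hGle hz)

end BorelCaratheodory

section QuadraticRemainder

variable {Φ χ : ℂ → ℂ} {U : Set ℂ} {a z : ℂ} {B t : ℝ}

theorem deriv_eq_of_quadratic_remainder (hU : IsOpen U) (hχ : DifferentiableOn ℂ χ U)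
    (hΦ : ∀ z ∈ U, Φ z = a * z + z ^ 2 * χ z) (hz : z ∈ U) :
    deriv Φ z = a + 2 * z * χ z + z ^ 2 * deriv χ z := by
  have hχz := (hχ.differentiableAt (hU.mem_nhds hz)).hasDerivAt
  have hsum := ((hasDerivAt_id z).const_mul a).add ((hasDerivAt_pow 2 z).mul hχz)
  refine (hsum.congr_of_eventuallyEq ?_).deriv.trans ?_
  · filter_upwards [hU.mem_nhds hz] with x hx using hΦ x hx
  · simp only [Nat.cast_ofNat, Nat.add_one_sub_one, pow_one]
    ring

theorem deriv_deriv_eq_of_quadratic_remainder (hU : IsOpen U) (hχ : DifferentiableOn ℂ χ U)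
    (hΦ : ∀ z ∈ U, Φ z = a * z + z ^ 2 * χ z) (hz : z ∈ U) :
    deriv (deriv Φ) z = 2 * χ z + 4 * z * deriv χ z + z ^ 2 * deriv (deriv χ) z := by
  have hχz := (hχ.differentiableAt (hU.mem_nhds hz)).hasDerivAt
  have hχz' := ((hχ.deriv hU).differentiableAt (hU.mem_nhds hz)).hasDerivAt
  have hsum := ((((hasDerivAt_id z).const_mul 2).mul hχz).const_add a).add
    ((hasDerivAt_pow 2 z).mul hχz')
  refine (hsum.congr_of_eventuallyEq ?_).deriv.trans ?_
  · filter_upwards [hU.mem_nhds hz] with x hx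
    exact deriv_eq_of_quadratic_remainder hU hχ hΦ hx
  · simp only [Nat.cast_ofNat, Nat.add_one_sub_one, pow_one, id_eq]
    ring

theorem norm_deriv_le_of_closedBall_subset (hχ : DifferentiableOn ℂ χ U)
    (hB : ∀ z ∈ U, ‖χ z‖ ≤ B) (ht : 0 < t) (hz : closedBall z t ⊆ U) : ‖deriv χ z‖ ≤ B / t :=
  Complex.norm_deriv_le_of_forall_mem_sphere_norm_le ht (hχ.diffContOnCl_ball hz)
    fun x hx ↦ hB x (hz (sphere_subset_closedBall hx))

theorem norm_deriv_deriv_le_of_closedBall_subset (hχ : DifferentiableOn ℂ χ U)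
    (hB : ∀ z ∈ U, ‖χ z‖ ≤ B) (ht : 0 < t) (hz : closedBall z t ⊆ U) :
    ‖deriv (deriv χ) z‖ ≤ 2 * B / t ^ 2 := by
  have hcauchy := Complex.norm_iteratedDeriv_le_of_forall_mem_sphere_norm_le 2 ht
    (hχ.diffContOnCl_ball hz) fun x hx ↦ hB x (hz (sphere_subset_closedBall hx))
  simpa [iteratedDeriv_succ] using hcauchy

theorem norm_mul_deriv_sub_linear_le (hU : IsOpen U) (hχ : DifferentiableOn ℂ χ U)
    (hΦ : ∀ z ∈ U, Φ z = a * z + z ^ 2 * χ z) (hB : ∀ z ∈ U, ‖χ z‖ ≤ B) (ht : 0 < t)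
    (hz : closedBall z t ⊆ U) :
    ‖z * deriv Φ z - a * z‖ ≤ B * ‖z‖ ^ 2 * (2 + ‖z‖ / t) := by
  have hzU : z ∈ U := hz (mem_closedBall_self ht.le)
  have hBz := hB z hzU
  have hχ' := norm_deriv_le_of_closedBall_subset hχ hB ht hz
  calc ‖z * deriv Φ z - a * z‖ = ‖z ^ 2 * (2 * χ z + z * deriv χ z)‖ := by
        rw [deriv_eq_of_quadratic_remainder hU hχ hΦ hzU]
        ring_nf
    _ ≤ ‖z‖ ^ 2 * (2 * ‖χ z‖ + ‖z‖ * ‖deriv χ z‖) := by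
        rw [norm_mul, norm_pow]
        gcongr
        exact (norm_add_le _ _).trans (by simp)
    _ ≤ ‖z‖ ^ 2 * (2 * B + ‖z‖ * (B / t)) := by gcongr
    _ = B * ‖z‖ ^ 2 * (2 + ‖z‖ / t) := by ring

theorem norm_sq_mul_deriv_deriv_le (hU : IsOpen U) (hχ : DifferentiableOn ℂ χ U)
    (hΦ : ∀ z ∈ U, Φ z = a * z + z ^ 2 * χ z) (hB : ∀ z ∈ U, ‖χ z‖ ≤ B) (ht : 0 < t)
    (hz : closedBall z t ⊆ U) :
    ‖z ^ 2 * deriv (deriv Φ) z‖ ≤ B * ‖z‖ ^ 2 * (2 + 4 * (‖z‖ / t) + 2 * (‖z‖ / t) ^ 2) := by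
  have hzU : z ∈ U := hz (mem_closedBall_self ht.le)
  have hBz := hB z hzU
  have hχ' := norm_deriv_le_of_closedBall_subset hχ hB ht hz
  have hχ'' := norm_deriv_deriv_le_of_closedBall_subset hχ hB ht hz
  calc ‖z ^ 2 * deriv (deriv Φ) z‖
      = ‖z‖ ^ 2 * ‖2 * χ z + 4 * z * deriv χ z + z ^ 2 * deriv (deriv χ) z‖ := by
        rw [deriv_deriv_eq_of_quadratic_remainder hU hχ hΦ hzU, norm_mul, norm_pow]
    _ ≤ ‖z‖ ^ 2 * (2 * ‖χ z‖ + 4 * ‖z‖ * ‖deriv χ z‖ + ‖z‖ ^ 2 * ‖deriv (deriv χ) z‖) := by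
        gcongr
        exact norm_add₃_le.trans (by simp)
    _ ≤ ‖z‖ ^ 2 * (2 * B + 4 * ‖z‖ * (B / t) + ‖z‖ ^ 2 * (2 * B / t ^ 2)) := by gcongr
    _ = B * ‖z‖ ^ 2 * (2 + 4 * (‖z‖ / t) + 2 * (‖z‖ / t) ^ 2) := by ring

end QuadraticRemainder

section RamanujanIdentities

open Derivative EisensteinSeries ModularForm MatrixGroups Manifold
open scoped Real

/- In the variable `q` the normalized derivative is `h⁻¹ q d/dq`, which vanishes at `q = 0`. -/
theorem tendsto_normalizedDeriv_atImInfty {F : ℍ → ℂ} {h : ℝ} (hh : 0 < h) (hF : MDiff F)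
    (hper : Function.Periodic (F ∘ ofComplex) h) (hbdd : IsBoundedAtImInfty F) :
    Tendsto (D F) atImInfty (𝓝 0) := by
  set φ := cuspFunction h F
  have hφ : AnalyticAt ℂ φ 0 := analyticAt_cuspFunction_zero hh hper hF hbdd
  have hlim : Tendsto (fun q : ℂ ↦ (h : ℂ)⁻¹ * (q * deriv φ q)) (𝓝 0) (𝓝 0) := by
    simpa [Pi.mul_def] using
      ((continuousAt_id.mul hφ.deriv.continuousAt).tendsto.const_mul (h : ℂ)⁻¹)
  refine (hlim.comp (qParam_tendsto_atImInfty hh)).congr fun τ ↦ ?_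
  have hq : HasDerivAt (Function.Periodic.qParam h)
      (2 * π * Complex.I / h * Function.Periodic.qParam h τ) (τ : ℂ) := by
    have hlin := ((hasDerivAt_id (τ : ℂ)).const_mul (2 * π * Complex.I)).div_const (h : ℂ)
    rw [mul_one] at hlin
    exact hlin.cexp.congr_deriv (mul_comm _ _)
  have hφd : DifferentiableAt ℂ φ (Function.Periodic.qParam h τ) :=
    differentiableAt_cuspFunction hh hper hF hbdd
      (Function.Periodic.norm_qParam_lt_one hh τ.im_pos)
  have heq : F ∘ ofComplex =ᶠ[𝓝 (τ : ℂ)] φ ∘ Function.Periodic.qParam h := by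
    filter_upwards [isOpen_upperHalfPlaneSet.mem_nhds τ.im_pos] with z hz
    rw [Function.comp_apply, Function.comp_apply, ofComplex_apply_of_im_pos hz]
    exact (eq_cuspFunction ⟨z, hz⟩ hh.ne' hper).symm
  rw [normalizedDerivOfComplex,
    ((hφd.hasDerivAt.comp (τ : ℂ) hq).congr_of_eventuallyEq heq).deriv, Function.comp_apply]
  field_simp

theorem periodic_comp_ofComplex_of_vadd {F : ℍ → ℂ} {h : ℝ} (hF : ∀ τ : ℍ, F (h +ᵥ τ) = F τ) :
    Function.Periodic (F ∘ ofComplex) h := by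
  intro w
  have him : (w + h).im = w.im := by simp
  by_cases! hw : 0 < w.im
  · simp only [Function.comp_apply, ofComplex_apply_of_im_pos hw,
      ofComplex_apply_of_im_pos (him ▸ hw)]
    rw [← hF ⟨w, hw⟩]
    congr 1
    ext
    simp [add_comm]
  · simp only [Function.comp_apply, ofComplex_apply_of_im_nonpos hw,
      ofComplex_apply_of_im_nonpos (him.trans_le hw)]

theorem periodic_E2_comp_ofComplex : Function.Periodic (E2 ∘ ofComplex) (1 : ℝ) := by
  refine periodic_comp_ofComplex_of_vadd fun τ ↦ ?_
  have hexp : Complex.exp (2 * π * Complex.I * (((1 : ℝ) +ᵥ τ : ℍ) : ℂ)) =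
      Complex.exp (2 * π * Complex.I * (τ : ℂ)) := by
    rw [UpperHalfPlane.coe_vadd, Complex.ofReal_one, mul_add, mul_one, add_comm,
      Complex.exp_periodic]
  rw [E2_eq_tsum_cexp, E2_eq_tsum_cexp]
  simp only [hexp]

theorem tendsto_E2_atImInfty : Tendsto E2 atImInfty (𝓝 1) := by
  have hφ := analyticAt_cuspFunction_zero one_pos periodic_E2_comp_ofComplex E2_mdifferentiable
    isBoundedAtImInfty_E2
  have hcusp : cuspFunction 1 E2 0 = 1 := by
    have hcoeff := (hasFPowerSeriesOnBall_cuspFunction one_pos hφ fun τ ↦ by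
      simpa only [Function.Periodic.qParam, Complex.ofReal_one, div_one]
        using hasSum_qExpansion_E2 τ).coeff_zero ![]
    simpa [FormalMultilinearSeries.ofScalars] using hcoeff.symm
  have hlim := hφ.continuousAt.tendsto.comp (qParam_tendsto_atImInfty one_pos)
  rw [hcusp] at hlim
  exact hlim.congr fun τ ↦ eq_cuspFunction τ one_ne_zero periodic_E2_comp_ofComplex

theorem tendsto_E_atImInfty {k : ℕ} (hk : 3 ≤ k) (hk2 : Even k) :
    Tendsto (E hk) atImInfty (𝓝 1) := by
  have hφ := ModularFormClass.analyticAt_cuspFunction_zero (E hk) one_pos one_mem_strictPeriods_SL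
  have hcusp : cuspFunction 1 (E hk) 0 = 1 := by
    simpa [qExpansion_coeff] using E_qExpansion_coeff_zero hk hk2
  have hlim := hφ.continuousAt.tendsto.comp (qParam_tendsto_atImInfty one_pos)
  rw [hcusp] at hlim
  exact hlim.congr fun τ ↦
    SlashInvariantFormClass.eq_cuspFunction _ τ one_mem_strictPeriods_SL one_ne_zero

/-- A holomorphic function invariant under `SL(2, ℤ)` in weight `k` with a limit at `i∞`, as a
modular form of level one. -/
def modularFormOfTendsto (k : ℤ) (F : ℍ → ℂ) (hF : MDiff F) (hinv : ∀ γ : SL(2, ℤ), F ∣[k] γ = F)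
    {c : ℂ} (hc : Tendsto F atImInfty (𝓝 c)) : ModularForm 𝒮ℒ k where
  toFun := F
  slash_action_eq' A hA := by
    obtain ⟨A, rfl⟩ := hA
    exact hinv A
  holo' := hF
  bdd_at_cusps' h := by
    rw [Subgroup.IsArithmetic.isCusp_iff_isCusp_SL2Z] at h
    rw [OnePoint.isBoundedAt_iff_forall_SL2Z h]
    intro γ _
    rw [hinv]
    exact hc.isBigO_one ℝ

theorem eq_smul_E_of_rank_one {k : ℕ} (hk : 3 ≤ k) (hk2 : Even k)
    (hrank : Module.rank ℂ (ModularForm 𝒮ℒ k) = 1) {F : ℍ → ℂ} (hF : MDiff F)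
    (hinv : ∀ γ : SL(2, ℤ), F ∣[(k : ℤ)] γ = F) {c : ℂ} (hc : Tendsto F atImInfty (𝓝 c)) :
    F = c • ⇑(E hk) := by
  obtain ⟨d, hd⟩ : ∃ d : ℂ, d • E hk = modularFormOfTendsto k F hF hinv hc :=
    (finrank_eq_one_iff_of_nonzero' (E hk) (E_ne_zero _ hk2)).mp
      (Module.rank_eq_one_iff_finrank_eq_one.mp hrank) _
  have hFd : F = d • ⇑(E hk) := congrArg DFunLike.coe hd.symm
  have hlim : Tendsto F atImInfty (𝓝 (d * 1)) :=
    hFd ▸ (tendsto_E_atImInfty hk hk2).const_mul d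
  rw [hFd, tendsto_nhds_unique hc hlim, mul_one]

theorem normalizedDeriv_E4 (τ : ℍ) : D E₄ τ = (E2 τ * E₄ τ - E₆ τ) / 3 := by
  have hm : MDiff (E₄ : ℍ → ℂ) := ModularFormClass.holo E₄
  have hper : Function.Periodic (E₄ ∘ ofComplex) (1 : ℝ) :=
    SlashInvariantFormClass.periodic_comp_ofComplex E₄ one_mem_strictPeriods_SL
  have hD := tendsto_normalizedDeriv_atImInfty one_pos hm hper (ModularFormClass.bdd_at_infty E₄)
  have hlim : Tendsto (serreDerivative ((4 : ℤ) : ℂ) E₄) atImInfty (𝓝 (-1 / 3)) := by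
    have hserre := hD.sub ((tendsto_E2_atImInfty.const_mul (4 * 12⁻¹)).mul
      (tendsto_E_atImInfty (k := 4) (by norm_num) ⟨2, rfl⟩))
    norm_num at hserre ⊢
    exact hserre
  have heq := congrFun (eq_smul_E_of_rank_one (k := 6) (by norm_num) ⟨3, rfl⟩
    levelOne_weight_six_rank_one (serreDerivative_mdifferentiable _ hm)
    (fun γ ↦ serreDerivative_slash_invariant (k := 4) hm
      (SlashInvariantForm.slash_action_eqn E₄.toSlashInvariantForm _ ⟨γ, rfl⟩)) hlim) τ
  rw [serreDerivative_apply, Pi.smul_apply, smul_eq_mul] at heq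
  push_cast at heq
  linear_combination heq

theorem hasDerivAt_E2_correction (γ : SL(2, ℤ)) (τ : ℍ) :
    HasDerivAt (((1 / (2 * riemannZeta 2)) • D2 γ) ∘ ofComplex)
      (2 * π * Complex.I * (((1 / (2 * riemannZeta 2)) • D2 γ) τ ^ 2 / 12)) τ := by
  have hdenom := (hasDerivAt_denom_zpow (γ : GL (Fin 2) ℝ) (-1) τ).const_mul
    (1 / (2 * riemannZeta 2) * (2 * π * Complex.I * γ 1 0))
  refine (hdenom.congr_of_eventuallyEq ?_).congr_deriv ?_
  · filter_upwards [isOpen_upperHalfPlaneSet.mem_nhds τ.im_pos] with w hw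
    simp only [Function.comp_apply, Pi.smul_apply, smul_eq_mul, D2, ofComplex_apply_of_im_pos hw,
      zpow_neg_one, div_eq_mul_inv, mul_assoc]
  · have hπ : (π : ℂ) ≠ 0 := Complex.ofReal_ne_zero.mpr Real.pi_ne_zero
    have hd : denom γ τ ≠ 0 := denom_ne_zero _ τ
    have hγ : (((γ : GL (Fin 2) ℝ) 1 0 : ℝ) : ℂ) = ((γ 1 0 : ℤ) : ℂ) := by simp
    rw [Pi.smul_apply, smul_eq_mul, D2, riemannZeta_two, hγ,
      show (-1 - 1 : ℤ) = -2 by norm_num, zpow_neg, zpow_ofNat]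
    push_cast
    field_simp
    linear_combination (-12 * (γ 1 0 : ℂ) ^ 2) * Complex.I_sq

theorem mdifferentiable_E2_correction (γ : SL(2, ℤ)) :
    MDiff ((1 / (2 * riemannZeta 2)) • D2 γ) := fun τ ↦
  UpperHalfPlane.mdifferentiableAt_iff.mpr (hasDerivAt_E2_correction γ τ).differentiableAt

theorem normalizedDeriv_E2_correction (γ : SL(2, ℤ)) :
    D ((1 / (2 * riemannZeta 2)) • D2 γ) = (12⁻¹ : ℂ) • ((1 / (2 * riemannZeta 2)) • D2 γ) ^ 2 := by
  ext τ
  have hπ := Complex.two_pi_I_ne_zero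
  rw [normalizedDerivOfComplex, (hasDerivAt_E2_correction γ τ).deriv, inv_mul_cancel_left₀ hπ,
    div_eq_inv_mul]
  rfl

/- With `E2 ∣ γ = E2 - u`, the correction `u` solves the Riccati equation `D u = u ^ 2 / 12`; this
is what makes the weight `1` Serre derivative of `E2` modular of weight `4`. -/
theorem serreDerivative_one_E2_slash (γ : SL(2, ℤ)) :
    serreDerivative 1 E2 ∣[(4 : ℤ)] γ = serreDerivative 1 E2 := by
  set u : ℍ → ℂ := (1 / (2 * riemannZeta 2)) • D2 γ
  have hslash : E2 ∣[(2 : ℤ)] γ = E2 - u := E2_slash_action γ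
  have hsplit :
      serreDerivative 1 E2 = serreDerivative ((2 : ℤ) : ℂ) E2 + (12⁻¹ : ℂ) • (E2 * E2) := by
    ext τ
    simp only [serreDerivative_apply, Pi.add_apply, Pi.smul_apply, Pi.mul_apply, smul_eq_mul]
    push_cast
    ring
  have hsquare : ((12⁻¹ : ℂ) • (E2 * E2)) ∣[(4 : ℤ)] γ = (12⁻¹ : ℂ) • ((E2 - u) * (E2 - u)) := by
    rw [ModularForm.SL_smul_slash, show (4 : ℤ) = 2 + 2 from rfl, ModularForm.mul_slash_SL2,
      hslash]
  have hserre : serreDerivative ((2 : ℤ) : ℂ) E2 ∣[(4 : ℤ)] γ =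
      serreDerivative ((2 : ℤ) : ℂ) (E2 - u) :=
    hslash ▸ serreDerivative_slash_equivariant (k := 2) E2_mdifferentiable
  rw [hsplit, SlashAction.add_slash, hsquare, hserre]
  ext τ
  have hD : D (E2 - u) τ = D E2 τ - 12⁻¹ * u τ ^ 2 := by
    rw [normalizedDerivOfComplex_sub _ _ E2_mdifferentiable (mdifferentiable_E2_correction γ),
      normalizedDeriv_E2_correction]
    rfl
  simp only [serreDerivative_apply, Pi.add_apply, Pi.smul_apply, Pi.mul_apply, Pi.sub_apply,
    smul_eq_mul, hD]
  push_cast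
  ring

theorem normalizedDeriv_E2 (τ : ℍ) : D E2 τ = (E2 τ ^ 2 - E₄ τ) / 12 := by
  have hD := tendsto_normalizedDeriv_atImInfty one_pos E2_mdifferentiable periodic_E2_comp_ofComplex
    isBoundedAtImInfty_E2
  have hlim : Tendsto (serreDerivative 1 E2) atImInfty (𝓝 (-1 / 12)) := by
    have hserre := hD.sub ((tendsto_E2_atImInfty.const_mul (1 * 12⁻¹)).mul tendsto_E2_atImInfty)
    norm_num at hserre ⊢
    exact hserre
  have heq := congrFun (eq_smul_E_of_rank_one (k := 4) (by norm_num) ⟨2, rfl⟩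
    levelOne_weight_four_rank_one (serreDerivative_mdifferentiable 1 E2_mdifferentiable)
    serreDerivative_one_E2_slash hlim) τ
  rw [serreDerivative_apply, Pi.smul_apply, smul_eq_mul] at heq
  linear_combination heq

theorem normalizedDeriv_discriminant (τ : ℍ) : D discriminant τ = E2 τ * discriminant τ := by
  have heq : discriminant ∘ ofComplex =ᶠ[𝓝 (τ : ℂ)] fun z ↦ eta z ^ 24 := by
    filter_upwards [isOpen_upperHalfPlaneSet.mem_nhds τ.im_pos] with z hz
    simp [discriminant, ofComplex_apply_of_im_pos hz]
  have hη := (differentiableAt_eta_of_mem_upperHalfPlaneSet τ.2).hasDerivAt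
  have hlog := logDeriv_eta_eq_E2 τ
  rw [logDeriv_apply, div_eq_iff (eta_ne_zero τ.2)] at hlog
  have hπ : (π : ℂ) ≠ 0 := Complex.ofReal_ne_zero.mpr Real.pi_ne_zero
  have hI : Complex.I ≠ 0 := Complex.I_ne_zero
  rw [normalizedDerivOfComplex, ((hη.pow 24).congr_of_eventuallyEq heq).deriv, hlog, discriminant]
  field_simp
  push_cast
  norm_num
  ring

end RamanujanIdentities

section DiscModel

open Derivative EisensteinSeries ModularForm MatrixGroups Manifold
open scoped Real

theorem rho_sq : rho ^ 2 = rho - 1 := by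
  have h3 : Real.sqrt 3 * Real.sqrt 3 = 3 := Real.mul_self_sqrt (by norm_num)
  apply Complex.ext
  · simp only [rho, pow_two, Complex.mul_re, Complex.sub_re, Complex.one_re]
    linarith
  · simp only [rho, pow_two, Complex.mul_im, Complex.sub_im, Complex.one_im]
    ring

theorem rho_pow_three : rho ^ 3 = -1 := by
  linear_combination (rho + 1) * rho_sq

theorem norm_rho : ‖rho‖ = 1 := by
  have hpow : ‖rho‖ ^ 3 = 1 := by rw [← norm_pow, rho_pow_three, norm_neg, norm_one]
  exact (pow_eq_one_iff_of_nonneg (norm_nonneg _) (by norm_num)).mp hpow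

theorem conj_rho : (starRingEnd ℂ) rho = 1 - rho := by
  apply Complex.ext
  · simp only [rho, Complex.conj_re, Complex.sub_re, Complex.one_re]
    norm_num
  · simp [rho]

theorem one_sub_two_mul_rho : 1 - 2 * rho = -(Real.sqrt 3 * Complex.I) := by
  apply Complex.ext
  · simp [rho]
  · simp [rho, mul_div_cancel₀]

theorem isPrimitiveRoot_rho_sq : IsPrimitiveRoot (rho ^ 2) 3 := by
  have hone : rho ^ 2 ≠ 1 := by
    intro h
    have him : Real.sqrt 3 / 2 = 0 := by
      simpa only [rho, Complex.sub_im, Complex.one_im, sub_zero] using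
        congrArg Complex.im (rho_sq.symm.trans h)
    exact (by positivity : Real.sqrt 3 / 2 ≠ 0) him
  have hpow : (rho ^ 2) ^ 3 = 1 := by
    rw [← pow_mul, mul_comm, pow_mul, rho_pow_three, neg_one_sq]
  have : Fact (Nat.Prime 3) := ⟨Nat.prime_three⟩
  exact orderOf_eq_prime hpow hone ▸ IsPrimitiveRoot.orderOf (rho ^ 2)

theorem rho_sq_mul_mem_ball {w : ℂ} {r : ℝ} (hw : w ∈ ball (0 : ℂ) r) :
    rho ^ 2 * w ∈ ball (0 : ℂ) r := by
  simpa [norm_rho] using hw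

theorem psi_zero : psi 0 = rho := by simp [psi]

theorem psi_eq (w : ℂ) : psi w = ((1 - rho) * w + rho) / (1 + w) := by
  rw [psi, conj_rho, add_comm 1 w]

theorem one_add_ne_zero_of_mem_ball {w : ℂ} (hw : w ∈ ball (0 : ℂ) 1) : 1 + w ≠ 0 := by
  intro h
  rw [mem_ball_zero_iff, eq_neg_of_add_eq_zero_right h, norm_neg, norm_one] at hw
  exact hw.false

theorem coe_ofComplex_psi {w : ℂ} (hw : w ∈ ball (0 : ℂ) 1) :
    ((ofComplex (psi w) : ℍ) : ℂ) = psi w := by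
  rw [ofComplex_apply_of_im_pos (psi_im_pos hw)]

theorem hasDerivAt_psi {w : ℂ} (hw : w ∈ ball (0 : ℂ) 1) :
    HasDerivAt psi (-(Real.sqrt 3 * Complex.I) / (1 + w) ^ 2) w := by
  have hnum : HasDerivAt (fun w ↦ (1 - rho) * w + rho) (1 - rho) w := by
    simpa using ((hasDerivAt_id w).const_mul (1 - rho)).add_const rho
  have hden : HasDerivAt (fun w : ℂ ↦ 1 + w) 1 w := (hasDerivAt_id w).const_add 1
  rw [show psi = fun w ↦ ((1 - rho) * w + rho) / (1 + w) from funext psi_eq]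
  refine (hnum.div hden (one_add_ne_zero_of_mem_ball hw)).congr_deriv ?_
  rw [← one_sub_two_mul_rho]
  ring

/-- The constant `2π√3`: since `ψ' = -i√3 / (1 + w)²`, differentiation in `w` is `2π√3 / (1 + w)²`
times the normalized derivative `(2πi)⁻¹ d/dτ`. -/
def discScale : ℝ := 2 * π * Real.sqrt 3

theorem hasDerivAt_comp_psi {F : ℍ → ℂ} (hF : MDiff F) {w : ℂ} (hw : w ∈ ball (0 : ℂ) 1) :
    HasDerivAt (fun w ↦ F (ofComplex (psi w)))
      (discScale * D F (ofComplex (psi w)) / (1 + w) ^ 2) w := by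
  have hFψ : HasDerivAt (F ∘ ofComplex) (deriv (F ∘ ofComplex) (psi w)) (psi w) :=
    coe_ofComplex_psi hw ▸
      (UpperHalfPlane.mdifferentiableAt_iff.mp (hF (ofComplex (psi w)))).hasDerivAt
  refine (hFψ.comp w (hasDerivAt_psi hw)).congr_deriv ?_
  have hπ : (π : ℂ) ≠ 0 := Complex.ofReal_ne_zero.mpr Real.pi_ne_zero
  have hI : Complex.I ≠ 0 := Complex.I_ne_zero
  have hw1 := one_add_ne_zero_of_mem_ball hw
  rw [normalizedDerivOfComplex, coe_ofComplex_psi hw, discScale]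
  push_cast
  field_simp
  rw [Complex.I_sq]
  ring

/-- The pullback to the disc along `ψ` of a function on `ℍ` regarded as a form of weight `n`. The
weight factor makes rotation by `2π/3` act on pullbacks of modular forms by a root of unity. -/
def discPullback (n : ℕ) (F : ℍ → ℂ) (w : ℂ) : ℂ := F (ofComplex (psi w)) / (1 + w) ^ n

theorem discPullback_zero (n : ℕ) (F : ℍ → ℂ) : discPullback n F 0 = F (ofComplex rho) := by
  simp [discPullback, psi_zero]

theorem hasDerivAt_discPullback {F : ℍ → ℂ} (hF : MDiff F) (n : ℕ) {w : ℂ}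
    (hw : w ∈ ball (0 : ℂ) 1) :
    HasDerivAt (discPullback n F)
      (discScale * discPullback (n + 2) (D F) w - n * discPullback n F w / (1 + w)) w := by
  have hw1 := one_add_ne_zero_of_mem_ball hw
  have hpow : HasDerivAt (fun w : ℂ ↦ (1 + w) ^ n) (n * (1 + w) ^ (n - 1) * 1) w :=
    ((hasDerivAt_id w).const_add 1).pow n
  refine ((hasDerivAt_comp_psi hF hw).div hpow (pow_ne_zero n hw1)).congr_deriv ?_
  rcases n with _ | n
  · simp [discPullback, mul_div_assoc]
  · simp only [Nat.add_sub_cancel, discPullback]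
    field_simp
    ring

theorem differentiableOn_discPullback {F : ℍ → ℂ} (hF : MDiff F) (n : ℕ) :
    DifferentiableOn ℂ (discPullback n F) (ball 0 1) := fun _ hw ↦
  (hasDerivAt_discPullback hF n hw).differentiableAt.differentiableWithinAt

theorem mdifferentiable_discriminant : MDiff discriminant := CuspForm.discriminant.holo'

theorem hHat_eq_discPullback : hHat = discPullback 12 discriminant := rfl

theorem differentiableOn_hHat : DifferentiableOn ℂ hHat (ball 0 1) :=
  differentiableOn_discPullback mdifferentiable_discriminant 12

theorem hHat_ne_zero {w : ℂ} (hw : w ∈ ball (0 : ℂ) 1) : hHat w ≠ 0 :=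
  div_ne_zero (discriminant_ne_zero _) (pow_ne_zero _ (one_add_ne_zero_of_mem_ball hw))

theorem jDisc_eq_div {w : ℂ} (hw : w ∈ ball (0 : ℂ) 1) :
    jDisc w = discPullback 4 E₄ w ^ 3 / hHat w := by
  have hw1 := one_add_ne_zero_of_mem_ball hw
  have hΔ := discriminant_ne_zero (ofComplex (psi w))
  rw [jDisc, jInv, discPullback, hHat]
  field_simp

theorem differentiableOn_jDisc : DifferentiableOn ℂ jDisc (ball 0 1) :=
  (((differentiableOn_discPullback (ModularFormClass.holo E₄) 4).pow 3).div differentiableOn_hHat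
    fun _ ↦ hHat_ne_zero).congr fun _ ↦ jDisc_eq_div

/-- The matrix of `τ ↦ -1 / (τ - 1)`, which fixes `ρ` and acts on the disc as multiplication by
`ρ²`. -/
def rhoStabilizer : SL(2, ℤ) := ⟨!![0, -1; 1, -1], by simp [Matrix.det_fin_two]⟩

theorem denom_rhoStabilizer (τ : ℍ) : denom (rhoStabilizer : GL (Fin 2) ℝ) τ = (τ : ℂ) - 1 := by
  rw [ModularGroup.denom_apply]
  simp [rhoStabilizer, sub_eq_add_neg]

theorem apply_rhoStabilizer_smul {F : ℍ → ℂ} {k : ℤ} (hF : F ∣[k] rhoStabilizer = F) (τ : ℍ) :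
    F (rhoStabilizer • τ) = ((τ : ℂ) - 1) ^ k * F τ := by
  have hslash := congrFun hF τ
  have hne : (τ : ℂ) - 1 ≠ 0 := denom_rhoStabilizer τ ▸ denom_ne_zero _ τ
  rw [ModularForm.SL_slash_apply, denom_rhoStabilizer] at hslash
  rw [← hslash, mul_left_comm, ← zpow_add₀ hne, add_neg_cancel, zpow_zero, mul_one]

theorem psi_sub_one {w : ℂ} (hw : w ∈ ball (0 : ℂ) 1) :
    psi w - 1 = rho ^ 2 * (1 + rho ^ 2 * w) / (1 + w) := by
  have hw1 := one_add_ne_zero_of_mem_ball hw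
  rw [psi_eq, eq_div_iff hw1, sub_mul, div_mul_cancel₀ _ hw1]
  linear_combination (-1 - rho * w - rho ^ 2 * w) * rho_sq

theorem psi_rotate {w : ℂ} (hw : w ∈ ball (0 : ℂ) 1) : psi (rho ^ 2 * w) = -1 / (psi w - 1) := by
  have hw2 := one_add_ne_zero_of_mem_ball (rho_sq_mul_mem_ball hw)
  have hρ : rho ≠ 0 := norm_pos_iff.mp (by simp [norm_rho])
  rw [psi_sub_one hw, psi_eq]
  field_simp
  linear_combination (-rho ^ 3 * w + rho * w + rho + w + 1) * rho_sq

theorem ofComplex_psi_rotate {w : ℂ} (hw : w ∈ ball (0 : ℂ) 1) :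
    ofComplex (psi (rho ^ 2 * w)) = rhoStabilizer • ofComplex (psi w) := by
  ext
  rw [coe_ofComplex_psi (rho_sq_mul_mem_ball hw), coe_specialLinearGroup_apply, psi_rotate hw]
  simp [rhoStabilizer, coe_ofComplex_psi hw, sub_eq_add_neg]

theorem discPullback_rotate {F : ℍ → ℂ} {n : ℕ} (hF : F ∣[(n : ℤ)] rhoStabilizer = F) {w : ℂ}
    (hw : w ∈ ball (0 : ℂ) 1) :
    discPullback n F (rho ^ 2 * w) = (rho ^ 2) ^ n * discPullback n F w := by
  have hw1 := one_add_ne_zero_of_mem_ball hw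
  have hw2 := one_add_ne_zero_of_mem_ball (rho_sq_mul_mem_ball hw)
  rw [discPullback, discPullback, ofComplex_psi_rotate hw, apply_rhoStabilizer_smul hF,
    coe_ofComplex_psi hw, psi_sub_one hw, zpow_natCast, div_pow, mul_pow]
  field_simp

theorem discriminant_slash (γ : SL(2, ℤ)) : discriminant ∣[(12 : ℤ)] γ = discriminant :=
  CuspForm.discriminant.slash_action_eq' _ ⟨γ, rfl⟩

theorem E4_slash (γ : SL(2, ℤ)) : (E₄ : ℍ → ℂ) ∣[(4 : ℤ)] γ = E₄ :=
  E₄.slash_action_eq' _ ⟨γ, rfl⟩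

theorem hHat_rotate {w : ℂ} (hw : w ∈ ball (0 : ℂ) 1) : hHat (rho ^ 2 * w) = hHat w := by
  have hpow : (rho ^ 2) ^ (3 * 4) = 1 := by
    rw [pow_mul, isPrimitiveRoot_rho_sq.pow_eq_one, one_pow]
  rw [hHat_eq_discPullback, discPullback_rotate (discriminant_slash _) hw, hpow, one_mul]

theorem discPullback_E4_rotate {w : ℂ} (hw : w ∈ ball (0 : ℂ) 1) :
    discPullback 4 E₄ (rho ^ 2 * w) = rho ^ 2 * discPullback 4 E₄ w := by
  rw [discPullback_rotate (E4_slash _) hw, pow_succ,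
    isPrimitiveRoot_rho_sq.pow_eq_one, one_mul]

theorem discPullback_E4_zero : discPullback 4 E₄ 0 = 0 := by
  have hrot := discPullback_E4_rotate (mem_ball_self one_pos)
  rw [mul_zero] at hrot
  exact eq_zero_of_mul_eq_self_left (isPrimitiveRoot_rho_sq.ne_one (by norm_num)) hrot.symm

theorem jDisc_rotate {w : ℂ} (hw : w ∈ ball (0 : ℂ) 1) : jDisc (rho ^ 2 * w) = jDisc w := by
  rw [jDisc_eq_div hw, jDisc_eq_div (rho_sq_mul_mem_ball hw), hHat_rotate hw,
    discPullback_E4_rotate hw, mul_pow, isPrimitiveRoot_rho_sq.pow_eq_one, one_mul]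

theorem exists_isCubicFactor : ∃ f : ℂ → ℂ, IsCubicFactor f := by
  simpa only [IsCubicFactor, one_pow] using exists_differentiableOn_comp_pow one_pos
    isPrimitiveRoot_rho_sq differentiableOn_jDisc fun _ ↦ jDisc_rotate

theorem exists_isLogBranch : ∃ L : ℂ → ℂ, IsLogBranch L :=
  exists_log_of_ne_zero differentiableOn_hHat fun _ ↦ hHat_ne_zero

theorem IsLogBranch.rotate {L : ℂ → ℂ} (hL : IsLogBranch L) {w : ℂ} (hw : w ∈ ball (0 : ℂ) 1) :
    L (rho ^ 2 * w) = L w := by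
  have hrot : DifferentiableOn ℂ (fun w ↦ L (rho ^ 2 * w)) (ball 0 1) :=
    hL.1.comp (differentiableOn_id.const_mul _) fun _ ↦ rho_sq_mul_mem_ball
  have hconst := sub_eq_sub_of_exp_eq isOpen_ball (convex_ball 0 1).isPreconnected hrot hL.1
    (fun x hx ↦ by rw [hL.2 _ (rho_sq_mul_mem_ball hx), hL.2 x hx, hHat_rotate hx])
    hw (mem_ball_self one_pos)
  rwa [mul_zero, sub_self, sub_eq_zero] at hconst

theorem IsLogBranch.exists_comp_cube {L : ℂ → ℂ} (hL : IsLogBranch L) :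
    ∃ Φ : ℂ → ℂ, DifferentiableOn ℂ Φ (ball 0 1) ∧ Φ 0 = 0 ∧
      ∀ w ∈ ball (0 : ℂ) 1, L w = L 0 + Φ (w ^ 3) := by
  obtain ⟨Φ, hΦ, hLΦ⟩ := exists_differentiableOn_comp_pow one_pos isPrimitiveRoot_rho_sq hL.1
    fun _ ↦ hL.rotate
  rw [one_pow] at hΦ
  have h0 : L 0 = Φ 0 := by simpa using hLΦ 0 (mem_ball_self one_pos)
  exact ⟨fun z ↦ Φ z - L 0, hΦ.sub_const _, by simp [h0], fun w hw ↦ by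
    rw [add_sub_cancel, hLΦ w hw]⟩

end DiscModel

section PeterssonNorm

open ModularForm MatrixGroups
open scoped Real

theorem norm_tprod_one_sub_pow_sub_one_le {q : ℂ} (hq : ‖q‖ < 1) :
    ‖∏' n : ℕ, (1 - q ^ (n + 1)) - 1‖ ≤ Real.exp (‖q‖ / (1 - ‖q‖)) - 1 := by
  have hsum : HasSum (fun n : ℕ ↦ ‖q‖ ^ (n + 1)) (‖q‖ / (1 - ‖q‖)) := by
    simpa only [pow_succ', div_eq_mul_inv] using
      (hasSum_geometric_of_lt_one (norm_nonneg q) hq).mul_left ‖q‖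
  refine le_of_tendsto ((multipliable_one_sub_pow hq).hasProd.sub_const 1).norm
    (Eventually.of_forall fun s ↦ ?_)
  have hfinite := Finset.norm_prod_one_add_sub_one_le s fun n : ℕ ↦ -q ^ (n + 1)
  simp only [← sub_eq_add_neg, norm_neg, norm_pow] at hfinite
  refine hfinite.trans (sub_le_sub_right (Real.exp_le_exp.mpr ?_) 1)
  exact sum_le_hasSum s (fun _ _ ↦ by positivity) hsum

theorem norm_discriminant_eq (τ : ℍ) : ‖discriminant τ‖ =
    Real.exp (-(2 * π * τ.im)) *
      ‖∏' n : ℕ, (1 - Function.Periodic.qParam 1 (τ : ℂ) ^ (n + 1))‖ ^ 24 := by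
  have hq : ‖Function.Periodic.qParam 1 (τ : ℂ)‖ < 1 :=
    Function.Periodic.norm_qParam_lt_one one_pos τ.im_pos
  rw [discriminant_eq_q_prod, norm_mul, (multipliable_one_sub_pow hq).tprod_pow, norm_pow,
    Function.Periodic.norm_qParam, coe_im, div_one, neg_mul, neg_mul]

theorem exp_neg_two_pi_mul_le {y : ℝ} (hy : 0 < y) (h : 3 ≤ 4 * y ^ 2) :
    Real.exp (-(2 * π * y)) ≤ 1 / 100 := by
  have hy' : 0.86 ≤ y := by nlinarith
  have hexp : (100 : ℝ) ≤ Real.exp 5 := by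
    calc (100 : ℝ) ≤ 2.7 ^ 5 := by norm_num
      _ ≤ Real.exp 1 ^ 5 := by
        gcongr
        linarith [Real.exp_one_gt_d9]
      _ = Real.exp 5 := by rw [← Real.exp_nat_mul]; norm_num
  calc Real.exp (-(2 * π * y)) ≤ Real.exp (-5) :=
        Real.exp_le_exp.mpr (by nlinarith [Real.pi_gt_d2])
    _ = (Real.exp 5)⁻¹ := Real.exp_neg 5
    _ ≤ 1 / 100 := by
      rw [one_div]
      exact inv_anti₀ (by norm_num) hexp

theorem norm_tprod_qParam_sub_one_le {τ : ℍ} (h : 3 ≤ 4 * τ.im ^ 2) :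
    ‖∏' n : ℕ, (1 - Function.Periodic.qParam 1 (τ : ℂ) ^ (n + 1)) - 1‖ ≤ 1 / 50 := by
  have hq : ‖Function.Periodic.qParam 1 (τ : ℂ)‖ ≤ 1 / 100 := by
    simpa [Function.Periodic.norm_qParam] using exp_neg_two_pi_mul_le τ.im_pos h
  set r := ‖Function.Periodic.qParam 1 (τ : ℂ)‖
  have hr : r / (1 - r) ≤ 1 / 99 := by
    rw [div_le_iff₀ (by linarith)]
    linarith
  have hexp : Real.exp (1 / 99) ≤ 1 / (1 - 1 / 99) :=
    Real.exp_bound_div_one_sub_of_interval (by norm_num) (by norm_num)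
  calc _ ≤ Real.exp (r / (1 - r)) - 1 := norm_tprod_one_sub_pow_sub_one_le (by linarith)
    _ ≤ Real.exp (1 / 99) - 1 := sub_le_sub_right (Real.exp_le_exp.mpr hr) 1
    _ ≤ 1 / (1 - 1 / 99) - 1 := sub_le_sub_right hexp 1
    _ ≤ 1 / 50 := by norm_num

theorem norm_discriminant_le {τ : ℍ} (h : 3 ≤ 4 * τ.im ^ 2) :
    ‖discriminant τ‖ ≤ 2 * Real.exp (-(2 * π * τ.im)) := by
  rw [norm_discriminant_eq, mul_comm (Real.exp _)]
  gcongr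
  set P := ∏' n : ℕ, (1 - Function.Periodic.qParam 1 (τ : ℂ) ^ (n + 1))
  have hnorm : ‖P‖ ≤ 51 / 50 := by
    have hsub := norm_sub_norm_le P 1
    rw [norm_one] at hsub
    linarith [norm_tprod_qParam_sub_one_le h]
  exact (pow_le_pow_left₀ (norm_nonneg P) hnorm 24).trans (by norm_num)

theorem le_norm_discriminant {τ : ℍ} (h : 3 ≤ 4 * τ.im ^ 2) :
    Real.exp (-(2 * π * τ.im)) / 2 ≤ ‖discriminant τ‖ := by
  rw [norm_discriminant_eq, div_eq_mul_inv]
  gcongr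
  set P := ∏' n : ℕ, (1 - Function.Periodic.qParam 1 (τ : ℂ) ^ (n + 1))
  have hnorm : 49 / 50 ≤ ‖P‖ := by
    have hsub := norm_sub_norm_le 1 P
    rw [norm_one, norm_sub_rev] at hsub
    linarith [norm_tprod_qParam_sub_one_le h]
  exact le_trans (by norm_num) (pow_le_pow_left₀ (by norm_num) hnorm 24)

/-- The Petersson norm of `Δ`, an `SL(2, ℤ)`-invariant function on `ℍ`. It is normalized without
the factor `(4π)⁶` that appears in `gInfty`. -/
def peterssonNorm (τ : ℍ) : ℝ := τ.im ^ 6 * ‖discriminant τ‖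

theorem peterssonNorm_smul (γ : SL(2, ℤ)) (τ : ℍ) :
    peterssonNorm (γ • τ) = peterssonNorm τ := by
  have hslash := congrFun (discriminant_slash γ) τ
  have hden : ‖denom (γ : GL (Fin 2) ℝ) τ‖ ≠ 0 := norm_ne_zero_iff.mpr (denom_ne_zero _ τ)
  rw [ModularForm.SL_slash_apply, zpow_neg, zpow_ofNat] at hslash
  rw [peterssonNorm, peterssonNorm, ← hslash, norm_mul, norm_inv, norm_pow,
    ModularGroup.im_smul_eq_div_normSq, Complex.normSq_eq_norm_sq]
  field_simp

theorem pow_six_mul_exp_neg_two_pi_mul_le {y : ℝ} (hy : 0 ≤ y) :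
    y ^ 6 * Real.exp (-(2 * π * y)) ≤ Real.exp (-6) := by
  have hle : y ≤ Real.exp (π / 3 * y - 1) := by
    nlinarith [Real.add_one_le_exp (π / 3 * y - 1), Real.pi_gt_three]
  calc y ^ 6 * Real.exp (-(2 * π * y))
      ≤ Real.exp (π / 3 * y - 1) ^ 6 * Real.exp (-(2 * π * y)) := by gcongr
    _ = Real.exp (-6) := by
      rw [← Real.exp_nat_mul, ← Real.exp_add]
      push_cast
      ring_nf

theorem peterssonNorm_le (τ : ℍ) : peterssonNorm τ ≤ 2 * Real.exp (-6) := by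
  obtain ⟨γ, hγ⟩ := ModularGroup.exists_smul_mem_fd τ
  rw [← peterssonNorm_smul γ, peterssonNorm]
  set σ := γ • τ
  calc σ.im ^ 6 * ‖discriminant σ‖ ≤ σ.im ^ 6 * (2 * Real.exp (-(2 * π * σ.im))) := by
        gcongr
        exact norm_discriminant_le (ModularGroup.three_le_four_mul_im_sq_of_mem_fd hγ)
    _ = 2 * (σ.im ^ 6 * Real.exp (-(2 * π * σ.im))) := by ring
    _ ≤ 2 * Real.exp (-6) := by
      gcongr
      exact pow_six_mul_exp_neg_two_pi_mul_le σ.im_pos.le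

theorem le_peterssonNorm_of_coe_eq_rho {τ : ℍ} (hτ : (τ : ℂ) = rho) :
    Real.exp (-6) / 5 ≤ peterssonNorm τ := by
  have him : τ.im = Real.sqrt 3 / 2 := by rw [← coe_im, hτ, rho]
  have him2 : τ.im ^ 2 = 3 / 4 := by
    rw [him, div_pow, Real.sq_sqrt (by norm_num)]
    norm_num
  have hexp : Real.exp (-6) ≤ Real.exp (-(2 * π * τ.im)) := by
    have hle : τ.im ≤ 0.9 := by nlinarith [τ.im_pos]
    exact Real.exp_le_exp.mpr (by nlinarith [Real.pi_lt_d2, τ.im_pos])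
  calc Real.exp (-6) / 5 ≤ (τ.im ^ 2) ^ 3 * (Real.exp (-6) / 2) := by
        rw [him2]
        linarith [Real.exp_pos (-6)]
    _ ≤ (τ.im ^ 2) ^ 3 * (Real.exp (-(2 * π * τ.im)) / 2) := by gcongr
    _ ≤ (τ.im ^ 2) ^ 3 * ‖discriminant τ‖ := by
      gcongr
      exact le_norm_discriminant (by rw [him2]; norm_num)
    _ = peterssonNorm τ := by rw [peterssonNorm, ← pow_mul]

theorem peterssonNorm_psi {w : ℂ} (hw : w ∈ ball (0 : ℂ) 1) :
    peterssonNorm (ofComplex (psi w)) = 27 / 64 * (‖hHat w‖ * (1 - ‖w‖ ^ 2) ^ 6) := by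
  have hw1 : ‖1 + w‖ ≠ 0 := norm_ne_zero_iff.mpr (one_add_ne_zero_of_mem_ball hw)
  have hsqrt : Real.sqrt 3 ^ 6 = 27 := by
    rw [show 6 = 2 * 3 from rfl, pow_mul, Real.sq_sqrt (by norm_num)]
    norm_num
  rw [peterssonNorm, ← coe_im, coe_ofComplex_psi hw, psi_im, hHat, norm_div, norm_pow, mul_pow,
    div_pow, div_pow, hsqrt]
  field_simp
  norm_num
  ring

theorem norm_hHat_le {w : ℂ} (hw : w ∈ ball (0 : ℂ) 1) :
    ‖hHat w‖ * (1 - ‖w‖ ^ 2) ^ 6 ≤ 10 * ‖hHat 0‖ := by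
  have h0 : (0 : ℂ) ∈ ball (0 : ℂ) 1 := mem_ball_self one_pos
  have hupper := peterssonNorm_le (ofComplex (psi w))
  have hlower := le_peterssonNorm_of_coe_eq_rho (τ := ofComplex (psi 0))
    (by rw [coe_ofComplex_psi h0, psi_zero])
  rw [peterssonNorm_psi hw] at hupper
  rw [peterssonNorm_psi h0, norm_zero, zero_pow two_ne_zero, sub_zero, one_pow, mul_one] at hlower
  linarith

theorem IsLogBranch.re_sub_le {L : ℂ → ℂ} (hL : IsLogBranch L) {w : ℂ} (hw : ‖w‖ ≤ 9 / 10) :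
    (L w - L 0).re ≤ 13 := by
  have hw1 : w ∈ ball (0 : ℂ) 1 := mem_ball_zero_iff.mpr (by linarith)
  have hratio : Real.exp (L w - L 0).re * (1 - ‖w‖ ^ 2) ^ 6 ≤ 10 := by
    have hle := norm_hHat_le hw1
    rw [← hL.2 w hw1, ← hL.2 0 (mem_ball_self one_pos), Complex.norm_exp, Complex.norm_exp] at hle
    rw [Complex.sub_re, Real.exp_sub, div_mul_eq_mul_div]
    exact (div_le_iff₀ (Real.exp_pos _)).mpr hle
  have hrad : (19 / 100 : ℝ) ≤ 1 - ‖w‖ ^ 2 := by nlinarith [norm_nonneg w]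
  rw [← Real.exp_le_exp]
  calc Real.exp (L w - L 0).re ≤ 10 / (19 / 100) ^ 6 := by
        rw [le_div_iff₀ (by norm_num)]
        exact le_trans (by gcongr) hratio
    _ ≤ 2.7 ^ 13 := by norm_num
    _ ≤ Real.exp 1 ^ 13 := by
      gcongr
      linarith [Real.exp_one_gt_d9]
    _ = Real.exp 13 := by rw [← Real.exp_nat_mul]; norm_num

theorem IsLogBranch.re_comp_cube_le {L Φ : ℂ → ℂ} (hL : IsLogBranch L)
    (hΦ : ∀ w ∈ ball (0 : ℂ) 1, L w = L 0 + Φ (w ^ 3)) {z : ℂ}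
    (hz : z ∈ ball (0 : ℂ) ((9 / 10) ^ 3)) : (Φ z).re ≤ 13 := by
  obtain ⟨w, rfl⟩ : ∃ w : ℂ, w ^ 3 = z := IsAlgClosed.exists_pow_nat_eq z three_pos
  have hw : ‖w‖ < 9 / 10 := by
    rw [mem_ball_zero_iff, norm_pow] at hz
    exact lt_of_pow_lt_pow_left₀ 3 (by norm_num) hz
  have hre := hL.re_sub_le hw.le
  rwa [hΦ w (mem_ball_zero_iff.mpr (by linarith)), add_sub_cancel_left] at hre

theorem IsLogBranch.gDisc_eq {L : ℂ → ℂ} (hL : IsLogBranch L) {w : ℂ}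
    (hw : w ∈ ball (0 : ℂ) 1) :
    gDisc w = -Real.log ((4 * π) ^ 6 * (27 / 64)) - (L w).re - 6 * Real.log (1 - ‖w‖ ^ 2) := by
  have hpos : 0 < 1 - ‖w‖ ^ 2 := by
    rw [mem_ball_zero_iff] at hw
    nlinarith [norm_nonneg w]
  rw [gDisc, gInfty, mul_pow, mul_assoc, ← peterssonNorm, peterssonNorm_psi hw, ← mul_assoc,
    ← hL.2 w hw, Complex.norm_exp, Real.log_mul (by positivity) (by positivity),
    Real.log_mul (Real.exp_ne_zero _) (by positivity), Real.log_exp, Real.log_pow]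
  push_cast
  ring

end PeterssonNorm

section CubicCoefficient

open Derivative EisensteinSeries ModularForm
open scoped Real

theorem mul_deriv_eq_of_eq_comp_pow {L Φ : ℂ → ℂ} {c w : ℂ} {n : ℕ}
    (hΦ : DifferentiableAt ℂ Φ (w ^ n)) (hL : L =ᶠ[𝓝 w] fun x ↦ c + Φ (x ^ n)) :
    w * deriv L w = n * (w ^ n * deriv Φ (w ^ n)) := by
  have hcomp : HasDerivAt (fun x ↦ c + Φ (x ^ n)) (deriv Φ (w ^ n) * (n * w ^ (n - 1))) w :=
    (hΦ.hasDerivAt.comp w (hasDerivAt_pow n w)).const_add c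
  rw [hL.deriv_eq, hcomp.deriv]
  rcases n with _ | n
  · simp
  · rw [Nat.add_sub_cancel]
    ring

theorem sq_mul_deriv_deriv_eq_of_eq_comp_pow {L Φ : ℂ → ℂ} {U V : Set ℂ} {c w : ℂ} {n : ℕ}
    (hU : IsOpen U) (hV : IsOpen V) (hUV : MapsTo (· ^ n) U V) (hΦ : DifferentiableOn ℂ Φ V)
    (hLd : DifferentiableOn ℂ L U) (hL : ∀ w ∈ U, L w = c + Φ (w ^ n)) (hw : w ∈ U) :
    w ^ 2 * deriv (deriv L) w = n ^ 2 * ((w ^ n) ^ 2 * deriv (deriv Φ) (w ^ n)) +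
      n * (n - 1) * (w ^ n * deriv Φ (w ^ n)) := by
  have hfirst : ∀ x ∈ U, x * deriv L x = n * (x ^ n * deriv Φ (x ^ n)) := fun x hx ↦
    mul_deriv_eq_of_eq_comp_pow (hΦ.differentiableAt (hV.mem_nhds (hUV hx)))
      (Filter.eventuallyEq_of_mem (hU.mem_nhds hx) hL)
  have hΦ' := ((hΦ.deriv hV).differentiableAt (hV.mem_nhds (hUV hw))).hasDerivAt
  have hΨ : HasDerivAt (fun z ↦ n * (z * deriv Φ z)) _ (w ^ n) :=
    ((hasDerivAt_id (w ^ n)).mul hΦ').const_mul (n : ℂ)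
  have hM : HasDerivAt (fun x ↦ x * deriv L x) _ w := (hasDerivAt_id w).mul
    ((hLd.deriv hU).differentiableAt (hU.mem_nhds hw)).hasDerivAt
  have hsecond := mul_deriv_eq_of_eq_comp_pow (L := fun x ↦ x * deriv L x) (c := 0)
    hΨ.differentiableAt <| by
      filter_upwards [hU.mem_nhds hw] with x hx
      rw [zero_add, hfirst x hx]
  rw [hM.deriv, hΨ.deriv] at hsecond
  simp only [id_eq] at hsecond
  linear_combination hsecond - hfirst w hw

theorem IsLogBranch.deriv_eq {L : ℂ → ℂ} (hL : IsLogBranch L) {w : ℂ}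
    (hw : w ∈ ball (0 : ℂ) 1) :
    deriv L w = discScale * discPullback 2 E2 w - 12 / (1 + w) := by
  have hw1 := one_add_ne_zero_of_mem_ball hw
  have hΔ := discriminant_ne_zero (ofComplex (psi w))
  rw [deriv_eq_div_of_exp_eq isOpen_ball hL.1 hL.2 hw, hHat_eq_discPullback,
    (hasDerivAt_discPullback mdifferentiable_discriminant 12 hw).deriv]
  simp only [discPullback, normalizedDeriv_discriminant]
  push_cast
  field_simp

theorem IsLogBranch.discPullback_E4_eq {L : ℂ → ℂ} (hL : IsLogBranch L) {w : ℂ}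
    (hw : w ∈ ball (0 : ℂ) 1) :
    discScale ^ 2 * discPullback 4 E₄ w = deriv L w ^ 2 - 12 * deriv (deriv L) w := by
  have hw1 := one_add_ne_zero_of_mem_ball hw
  have hpull := (hasDerivAt_discPullback E2_mdifferentiable 2 hw).const_mul (discScale : ℂ)
  have hpole : HasDerivAt (fun w : ℂ ↦ 12 / (1 + w)) (12 * (-1 / (1 + w) ^ 2)) w := by
    simpa [div_eq_mul_inv] using (((hasDerivAt_id w).const_add 1).inv hw1).const_mul 12
  have heq : deriv L =ᶠ[𝓝 w] fun w ↦ discScale * discPullback 2 E2 w - 12 / (1 + w) := by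
    filter_upwards [isOpen_ball.mem_nhds hw] with x hx using hL.deriv_eq hx
  rw [((hpull.sub hpole).congr_of_eventuallyEq heq).deriv, hL.deriv_eq hw]
  simp only [discPullback, normalizedDeriv_E2]
  field_simp
  push_cast
  ring

theorem E4_rho : E₄ (ofComplex rho) = 0 := by
  rw [← discPullback_zero 4 E₄, discPullback_E4_zero]

theorem hHat_zero : hHat 0 = -E₆ (ofComplex rho) ^ 2 / 1728 := by
  rw [hHat_eq_discPullback, discPullback_zero, discriminant_eq_E₄_cube_sub_E₆_sq, E4_rho]
  ring

theorem deriv_discPullback_E4_zero :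
    deriv (discPullback 4 E₄) 0 = -(discScale * E₆ (ofComplex rho) / 3) := by
  rw [(hasDerivAt_discPullback (ModularFormClass.holo E₄) 4 (mem_ball_self one_pos)).deriv,
    discPullback_zero, discPullback_zero, normalizedDeriv_E4, E4_rho]
  ring

theorem continuousAt_dslope_discPullback_E4 : ContinuousAt (dslope (discPullback 4 E₄) 0) 0 :=
  continuousAt_dslope_same.mpr
    (hasDerivAt_discPullback (ModularFormClass.holo E₄) 4 (mem_ball_self one_pos)).differentiableAt

theorem mul_dslope_discPullback_E4 (w : ℂ) :
    w * dslope (discPullback 4 E₄) 0 w = discPullback 4 E₄ w := by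
  simpa [discPullback_E4_zero] using sub_smul_dslope (discPullback 4 E₄) 0 w

theorem IsCubicFactor.deriv_zero {f : ℂ → ℂ} (hf : IsCubicFactor f) :
    deriv f 0 = 64 * discScale ^ 3 * E₆ (ofComplex rho) := by
  have h0 : (0 : ℂ) ∈ ball (0 : ℂ) 1 := mem_ball_self one_pos
  have hlim : deriv f 0 = dslope (discPullback 4 E₄) 0 0 ^ 3 / hHat 0 := by
    refine deriv_zero_eq_of_comp_pow three_ne_zero (hf.1.differentiableAt (isOpen_ball.mem_nhds h0))
      ((continuousAt_dslope_discPullback_E4.pow 3).div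
        (differentiableOn_hHat.differentiableAt (isOpen_ball.mem_nhds h0)).continuousAt
        (hHat_ne_zero h0)) ?_
    filter_upwards [isOpen_ball.mem_nhds h0] with w hw
    rw [← hf.2 w hw, jDisc_eq_div hw, ← mul_dslope_discPullback_E4, mul_pow, mul_div_assoc]
    rfl
  have hE6 : E₆ (ofComplex rho) ≠ 0 := by
    intro h
    exact hHat_ne_zero h0 (by rw [hHat_zero, h]; norm_num)
  rw [hlim, dslope_same, deriv_discPullback_E4_zero, hHat_zero]
  field_simp
  ring

theorem mapsTo_pow_ball_one {n : ℕ} (hn : n ≠ 0) : MapsTo (· ^ n) (ball (0 : ℂ) 1) (ball 0 1) := by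
  intro w hw
  rw [mem_ball_zero_iff] at hw ⊢
  rw [norm_pow]
  exact pow_lt_one₀ (norm_nonneg w) hw hn

theorem mul_deriv_eq_of_comp_cube {L Φ : ℂ → ℂ} (hΦ : DifferentiableOn ℂ Φ (ball 0 1))
    (hLΦ : ∀ w ∈ ball (0 : ℂ) 1, L w = L 0 + Φ (w ^ 3)) {w : ℂ} (hw : w ∈ ball (0 : ℂ) 1) :
    w * deriv L w = 3 * (w ^ 3 * deriv Φ (w ^ 3)) :=
  mul_deriv_eq_of_eq_comp_pow
    (hΦ.differentiableAt (isOpen_ball.mem_nhds (mapsTo_pow_ball_one three_ne_zero hw)))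
    (Filter.eventuallyEq_of_mem (isOpen_ball.mem_nhds hw) hLΦ)

theorem sq_mul_deriv_deriv_eq_of_comp_cube {L Φ : ℂ → ℂ} (hL : DifferentiableOn ℂ L (ball 0 1))
    (hΦ : DifferentiableOn ℂ Φ (ball 0 1)) (hLΦ : ∀ w ∈ ball (0 : ℂ) 1, L w = L 0 + Φ (w ^ 3))
    {w : ℂ} (hw : w ∈ ball (0 : ℂ) 1) :
    w ^ 2 * deriv (deriv L) w =
      9 * ((w ^ 3) ^ 2 * deriv (deriv Φ) (w ^ 3)) + 6 * (w ^ 3 * deriv Φ (w ^ 3)) := by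
  have hsecond := sq_mul_deriv_deriv_eq_of_eq_comp_pow isOpen_ball isOpen_ball
    (mapsTo_pow_ball_one three_ne_zero) hΦ hL hLΦ hw
  push_cast at hsecond
  linear_combination hsecond

theorem IsLogBranch.deriv_comp_cube_zero {L Φ : ℂ → ℂ} (hL : IsLogBranch L)
    (hΦ : DifferentiableOn ℂ Φ (ball 0 1)) (hLΦ : ∀ w ∈ ball (0 : ℂ) 1, L w = L 0 + Φ (w ^ 3)) :
    216 * deriv Φ 0 = discScale ^ 3 * E₆ (ofComplex rho) := by
  have hnhds : ball (0 : ℂ) 1 ∈ 𝓝 0 := isOpen_ball.mem_nhds (mem_ball_self one_pos)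
  let g : ℂ → ℂ := fun z ↦ 9 * z * deriv Φ z ^ 2 - 108 * z * deriv (deriv Φ) z - 72 * deriv Φ z
  have hg : HasDerivAt (fun z ↦ z * g z) (g 0) 0 := by
    have hΦ1 := (hΦ.deriv isOpen_ball).differentiableAt hnhds
    have hΦ2 := ((hΦ.deriv isOpen_ball).deriv isOpen_ball).differentiableAt hnhds
    have hgd : DifferentiableAt ℂ g 0 := by fun_prop
    exact ((hasDerivAt_id (0 : ℂ)).mul hgd.hasDerivAt).congr_deriv (by simp)
  have hode : ∀ w ∈ ball (0 : ℂ) 1,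
      w ^ 3 * g (w ^ 3) = w ^ 3 * (discScale ^ 2 * dslope (discPullback 4 E₄) 0 w) := fun w hw ↦ by
    have hfirst := mul_deriv_eq_of_comp_cube hΦ hLΦ hw
    have hsecond := sq_mul_deriv_deriv_eq_of_comp_cube hL.1 hΦ hLΦ hw
    have hE4 := hL.discPullback_E4_eq hw
    rw [← mul_dslope_discPullback_E4] at hE4
    simp only [g]
    linear_combination -(w * deriv L w + 3 * (w ^ 3 * deriv Φ (w ^ 3))) * hfirst +
      12 * hsecond - w ^ 2 * hE4
  have hcoeff := deriv_zero_eq_of_comp_pow three_ne_zero hg.differentiableAt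
    (continuousAt_dslope_discPullback_E4.const_mul _) (Filter.eventually_of_mem hnhds hode)
  rw [hg.deriv, dslope_same, deriv_discPullback_E4_zero] at hcoeff
  simp only [g] at hcoeff
  linear_combination -3 * hcoeff

theorem IsCubicFactor.deriv_zero_eq_deriv_comp_cube {f L Φ : ℂ → ℂ} (hf : IsCubicFactor f)
    (hL : IsLogBranch L) (hΦ : DifferentiableOn ℂ Φ (ball 0 1))
    (hLΦ : ∀ w ∈ ball (0 : ℂ) 1, L w = L 0 + Φ (w ^ 3)) : deriv f 0 = 13824 * deriv Φ 0 := by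
  linear_combination hf.deriv_zero - 64 * hL.deriv_comp_cube_zero hΦ hLΦ

theorem im_E_eq_zero {k : ℕ} (hk : 3 ≤ k) (hk2 : Even k) {τ : ℍ} {q : ℝ}
    (hq : Complex.exp (2 * π * Complex.I * τ) = q) : (E hk τ).im = 0 := by
  rw [q_expansion_bernoulli hk hk2 τ, hq]
  norm_cast

theorem exp_two_pi_I_mul_rho :
    Complex.exp (2 * π * Complex.I * rho) = (-Real.exp (-(π * Real.sqrt 3)) : ℝ) := by
  have harg : 2 * π * Complex.I * rho = π * Complex.I + (-(π * Real.sqrt 3) : ℝ) := by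
    apply Complex.ext <;> simp [rho] <;> ring
  rw [harg, Complex.exp_add, Complex.exp_pi_mul_I]
  push_cast
  ring

theorem im_E6_rho : (E₆ (ofComplex rho)).im = 0 := by
  have hρ : ((ofComplex rho : ℍ) : ℂ) = rho := by
    rw [← psi_zero, coe_ofComplex_psi (mem_ball_self one_pos)]
  exact im_E_eq_zero (by norm_num) (by decide) (by rw [hρ, exp_two_pi_I_mul_rho])

theorem IsCubicFactor.im_deriv_zero {f : ℂ → ℂ} (hf : IsCubicFactor f) : (deriv f 0).im = 0 := by
  rw [hf.deriv_zero, show 64 * (discScale : ℂ) ^ 3 = (64 * discScale ^ 3 : ℝ) by push_cast; rfl,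
    Complex.im_ofReal_mul, im_E6_rho, mul_zero]

end CubicCoefficient

section Estimates

open scoped Real

theorem IsLogBranch.exists_quadratic_remainder {L Φ : ℂ → ℂ} (hL : IsLogBranch L)
    (hΦ : DifferentiableOn ℂ Φ (ball 0 1)) (hΦ0 : Φ 0 = 0)
    (hLΦ : ∀ w ∈ ball (0 : ℂ) 1, L w = L 0 + Φ (w ^ 3)) :
    ∃ χ : ℂ → ℂ, DifferentiableOn ℂ χ (ball 0 (1 / 20)) ∧
      (∀ z ∈ ball (0 : ℂ) (1 / 20), Φ z = deriv Φ 0 * z + z ^ 2 * χ z) ∧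
      ∀ z ∈ ball (0 : ℂ) (1 / 20), ‖χ z‖ ≤ 158 := by
  obtain ⟨χ, hχ, hexp, hbound⟩ := exists_quadratic_remainder_of_re_le (R := (9 / 10) ^ 3)
    (by norm_num) (by norm_num) (hΦ.mono (ball_subset_ball (by norm_num))) hΦ0
    fun z hz ↦ hL.re_comp_cube_le hLΦ hz
  have hsub : ball (0 : ℂ) (1 / 20) ⊆ ball 0 ((9 / 10) ^ 3) := ball_subset_ball (by norm_num)
  refine ⟨χ, hχ.mono hsub, fun z hz ↦ hexp z (hsub hz), fun z hz ↦ (hbound z (hsub hz)).trans ?_⟩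
  rw [mem_ball_zero_iff] at hz
  rw [div_le_iff₀ (by nlinarith)]
  nlinarith

theorem closedBall_subset_ball_of_norm_le {z : ℂ} (hz : ‖z‖ ≤ 1 / 1000) :
    closedBall z (1 / 50) ⊆ ball (0 : ℂ) (1 / 20) :=
  closedBall_subset_ball' (by rw [dist_zero_right]; linarith)

theorem norm_pow_three_le {w : ℂ} (hw : ‖w‖ ≤ 1 / 10) : ‖w ^ 3‖ ≤ 1 / 1000 := by
  rw [norm_pow]
  exact (pow_le_pow_left₀ (norm_nonneg w) hw 3).trans (by norm_num)

theorem IsLogBranch.norm_comp_cube_bounds {L Φ : ℂ → ℂ} (hL : IsLogBranch L)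
    (hΦ : DifferentiableOn ℂ Φ (ball 0 1)) (hΦ0 : Φ 0 = 0)
    (hLΦ : ∀ w ∈ ball (0 : ℂ) 1, L w = L 0 + Φ (w ^ 3)) {z : ℂ} (hz : ‖z‖ ≤ 1 / 1000) :
    ‖Φ z - deriv Φ 0 * z‖ ≤ 158 * ‖z‖ ^ 2 ∧
      ‖z * deriv Φ z - deriv Φ 0 * z‖ ≤ 324 * ‖z‖ ^ 2 ∧
      ‖z ^ 2 * deriv (deriv Φ) z‖ ≤ 349 * ‖z‖ ^ 2 := by
  obtain ⟨χ, hχ, hexp, hbound⟩ := hL.exists_quadratic_remainder hΦ hΦ0 hLΦ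
  have hball := closedBall_subset_ball_of_norm_le hz
  have hzU := hball (mem_closedBall_self (by norm_num))
  have hratio : ‖z‖ / (1 / 50) ≤ 1 / 20 := by linarith
  refine ⟨?_, ?_, ?_⟩
  · rw [hexp z hzU, add_sub_cancel_left, norm_mul, norm_pow, mul_comm]
    gcongr
    exact hbound z hzU
  · refine (norm_mul_deriv_sub_linear_le isOpen_ball hχ hexp hbound (by norm_num) hball).trans ?_
    nlinarith [mul_le_mul_of_nonneg_right hratio (sq_nonneg ‖z‖)]
  · refine (norm_sq_mul_deriv_deriv_le isOpen_ball hχ hexp hbound (by norm_num) hball).trans ?_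
    have hsq : (‖z‖ / (1 / 50)) ^ 2 ≤ 1 / 400 := by nlinarith [norm_nonneg z]
    nlinarith [sq_nonneg ‖z‖]

variable {f L : ℂ → ℂ} {w : ℂ}

theorem abs_gDisc_sub_le (hf : IsCubicFactor f) (hL : IsLogBranch L) (hw : ‖w‖ ≤ 1 / 10) :
    |gDisc w - (gDisc 0 - 6 * Real.log (1 - ‖w‖ ^ 2) - (deriv f 0).re / 13824 * (w ^ 3).re)| ≤
      6 ^ 3 * ‖w‖ ^ 6 := by
  obtain ⟨Φ, hΦ, hΦ0, hLΦ⟩ := hL.exists_comp_cube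
  have hw1 : w ∈ ball (0 : ℂ) 1 := mem_ball_zero_iff.mpr (by linarith)
  have hcoeff := hf.deriv_zero_eq_deriv_comp_cube hL hΦ hLΦ
  have him : (deriv Φ 0).im = 0 := by
    simpa [hcoeff] using hf.im_deriv_zero
  have hbound := (hL.norm_comp_cube_bounds hΦ hΦ0 hLΦ (norm_pow_three_le hw)).1
  have heq : gDisc w -
      (gDisc 0 - 6 * Real.log (1 - ‖w‖ ^ 2) - (deriv f 0).re / 13824 * (w ^ 3).re) =
        -(Φ (w ^ 3) - deriv Φ 0 * w ^ 3).re := by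
    rw [hL.gDisc_eq hw1, hL.gDisc_eq (mem_ball_self one_pos), hLΦ w hw1, hcoeff]
    simp only [Complex.add_re, Complex.sub_re, Complex.mul_re, him, Complex.re_ofNat,
      Complex.im_ofNat, norm_zero, zero_pow two_ne_zero, sub_zero, Real.log_one]
    ring
  calc _ = |(Φ (w ^ 3) - deriv Φ 0 * w ^ 3).re| := by rw [heq, abs_neg]
    _ ≤ ‖Φ (w ^ 3) - deriv Φ 0 * w ^ 3‖ := Complex.abs_re_le_norm _
    _ ≤ 158 * ‖w ^ 3‖ ^ 2 := hbound
    _ ≤ 6 ^ 3 * ‖w‖ ^ 6 := by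
      rw [norm_pow, ← pow_mul]
      gcongr
      norm_num

theorem norm_deriv_mul_sub_le (hf : IsCubicFactor f) (hL : IsLogBranch L) (hw : ‖w‖ ≤ 1 / 10) :
    ‖deriv L w * w - 3 * deriv f 0 / 13824 * w ^ 3‖ ≤ 6 ^ 4 * ‖w‖ ^ 6 := by
  obtain ⟨Φ, hΦ, hΦ0, hLΦ⟩ := hL.exists_comp_cube
  have hw1 : w ∈ ball (0 : ℂ) 1 := mem_ball_zero_iff.mpr (by linarith)
  obtain ⟨-, hfirst, -⟩ := hL.norm_comp_cube_bounds hΦ hΦ0 hLΦ (norm_pow_three_le hw)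
  have heq : deriv L w * w - 3 * deriv f 0 / 13824 * w ^ 3 =
      3 * (w ^ 3 * deriv Φ (w ^ 3) - deriv Φ 0 * w ^ 3) := by
    rw [hf.deriv_zero_eq_deriv_comp_cube hL hΦ hLΦ]
    linear_combination mul_deriv_eq_of_comp_cube hΦ hLΦ hw1
  calc _ = 3 * ‖w ^ 3 * deriv Φ (w ^ 3) - deriv Φ 0 * w ^ 3‖ := by
        rw [heq, norm_mul, Complex.norm_ofNat]
    _ ≤ 3 * (324 * ‖w ^ 3‖ ^ 2) := by gcongr
    _ ≤ 6 ^ 4 * ‖w‖ ^ 6 := by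
      rw [norm_pow, ← pow_mul, ← mul_assoc]
      gcongr
      norm_num

theorem norm_deriv_deriv_mul_sub_le (hf : IsCubicFactor f) (hL : IsLogBranch L)
    (hw : ‖w‖ ≤ 1 / 10) :
    ‖deriv (deriv L) w * w ^ 2 - 6 * deriv f 0 / 13824 * w ^ 3‖ ≤ 5 * 6 ^ 4 * ‖w‖ ^ 6 := by
  obtain ⟨Φ, hΦ, hΦ0, hLΦ⟩ := hL.exists_comp_cube
  have hw1 : w ∈ ball (0 : ℂ) 1 := mem_ball_zero_iff.mpr (by linarith)
  obtain ⟨-, hfirst, hsecond⟩ := hL.norm_comp_cube_bounds hΦ hΦ0 hLΦ (norm_pow_three_le hw)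
  have heq : deriv (deriv L) w * w ^ 2 - 6 * deriv f 0 / 13824 * w ^ 3 =
      9 * ((w ^ 3) ^ 2 * deriv (deriv Φ) (w ^ 3)) +
        6 * (w ^ 3 * deriv Φ (w ^ 3) - deriv Φ 0 * w ^ 3) := by
    rw [hf.deriv_zero_eq_deriv_comp_cube hL hΦ hLΦ]
    linear_combination sq_mul_deriv_deriv_eq_of_comp_cube hL.1 hΦ hLΦ hw1
  calc _ ≤ 9 * ‖(w ^ 3) ^ 2 * deriv (deriv Φ) (w ^ 3)‖ +
          6 * ‖w ^ 3 * deriv Φ (w ^ 3) - deriv Φ 0 * w ^ 3‖ := by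
        rw [heq]
        refine (norm_add_le _ _).trans_eq ?_
        rw [norm_mul, norm_mul (6 : ℂ), Complex.norm_ofNat, Complex.norm_ofNat]
    _ ≤ 9 * (349 * ‖w ^ 3‖ ^ 2) + 6 * (324 * ‖w ^ 3‖ ^ 2) := by gcongr
    _ = 5085 * ‖w‖ ^ 6 := by
      rw [norm_pow]
      ring
    _ ≤ 5 * 6 ^ 4 * ‖w‖ ^ 6 := by
      gcongr
      norm_num

theorem one_sub_pi_div_two_sqrt_three_le : 1 - π / (2 * Real.sqrt 3) ≤ 1 / 10 := by
  have hsqrt : Real.sqrt 3 ≤ 1.74 := by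
    rw [Real.sqrt_le_left (by norm_num)]
    norm_num
  have hdiv : 9 / 10 ≤ π / (2 * Real.sqrt 3) := by
    rw [le_div_iff₀ (by positivity)]
    linarith [Real.pi_gt_d2]
  linarith

end Estimates

end FaltingsApprox

end

open FaltingsApprox

theorem mainTheorem8 :
    (∃ f : ℂ → ℂ, FaltingsApprox.IsCubicFactor f) ∧
    (∃ L : ℂ → ℂ, FaltingsApprox.IsLogBranch L) ∧
    ∀ f L : ℂ → ℂ, FaltingsApprox.IsCubicFactor f → FaltingsApprox.IsLogBranch L →
      (deriv f 0).im = 0 ∧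
      ∀ w ∈ Metric.ball (0 : ℂ) 1, ‖w‖ ≤ 1 - Real.pi / (2 * Real.sqrt 3) →
        |FaltingsApprox.gDisc w -
            (FaltingsApprox.gDisc 0 - 6 * Real.log (1 - ‖w‖ ^ 2)
              - (deriv f 0).re / 13824 * (w ^ 3).re)| ≤ 6 ^ 3 * ‖w‖ ^ 6 ∧
        ‖deriv L w * w - 3 * deriv f 0 / 13824 * w ^ 3‖ ≤ 6 ^ 4 * ‖w‖ ^ 6 ∧
        ‖deriv (deriv L) w * w ^ 2 - 6 * deriv f 0 / 13824 * w ^ 3‖ ≤ 5 * 6 ^ 4 * ‖w‖ ^ 6 := by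
  refine ⟨exists_isCubicFactor, exists_isLogBranch, fun f L hf hL ↦
    ⟨hf.im_deriv_zero, fun w _ hw ↦ ?_⟩⟩
  have hw' : ‖w‖ ≤ 1 / 10 := hw.trans one_sub_pi_div_two_sqrt_three_le
  exact ⟨abs_gDisc_sub_le hf hL hw', norm_deriv_mul_sub_le hf hL hw',
    norm_deriv_deriv_mul_sub_le hf hL hw'⟩
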